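/- Consider the dispersionless system $\mathcal E$: $u_t=ww_x+v_x,\ v_t=-uw_x-3u_xw,\ w_t=u_x$. Differential functions on an open set $W$ of the infinite jet space (coordinates $x,t,u_k,v_k,w_k$, $k\ge 0$) are smooth functions on $W$ of finitely many of these coordinates. Let $D_x$ be the total $x$-derivative, $D_t$ the total $t$-derivative on $\mathcal E$, $\mathscr E_\varphi=\sum_{k,a} D_x^k(\varphi^a)\,\partial/\partial u^a_k$ with $(u^1,u^2,u^3)=(u,v,w)$, and $[\varphi,\psi]=\mathscr E_\varphi(\psi)-\mathscr E_\psi(\varphi)$ the standard bracket. Let $f$ be the triple of right-hand sides of $\mathcal E$ and $\ell_f\varphi=\mathscr E_\varphi(f)$ its linearization; $\mathrm{sym}\,\mathcal E$ consists of the triples $\varphi$ of differential functions on $W$ with $D_t\varphi=\ell_f\varphi$, and $\mathrm{cosym}\,\mathcal E$ of those $\psi$ with $D_t\psi+\ell_f^*\psi=0$. Put $$A_0=\begin{pmatrix} ww_x+v_x & -3u_xw-uw_x & u_x\\ -3u_xw-uw_x & -3w^2w_x-4v_xw-uu_x & v_x\\ u_x & v_x & w_x\end{pmatrix},\qquad \hat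 A_1=\begin{pmatrix} D_x&0&0\\0&-4wD_x-2w_x&D_x\\0&D_x&0\end{pmatrix},$$ $$\hat A_2=\begin{pmatrix}(2w^2+4v)D_x+2(ww_x+v_x)&-11uwD_x-(5u_xw+9uw_x)&3uD_x+u_x\\-11uwD_x-6u_xw-2uw_x&2hD_x+h_x&4vD_x+v_x\\3uD_x+2u_x&4vD_x+3v_x&2wD_x+w_x\end{pmatrix},$$ $h=-(\tfrac32u^2+8vw+3w^3)$, $h_x=D_xh$. For $p=(p^u,p^v,p^w)$ and $q=(q^u,q^v,q^w)$, with subscript $x$ denoting $D_x$, put $\{\!\{p,q\}\!\}_{\hat A_1}=(0,0,2(p^vq^v_x-p^v_xq^v))$, and let $\{\!\{p,q\}\!\}_{\hat A_2}$ have the components $$\begin{aligned} &2(p^w_xq^u-p^uq^w_x)+6w(p^uq^v_x-p^v_xq^u)+5w(p^vq^u_x-p^u_xq^v)+p^u_xq^w-p^wq^u_x+4w_x(p^uq^v-p^vq^u)+3u(p^vq^v_x-p^v_xq^v),\\ &2(p^u_xq^u-p^uq^u_x)+8w(p^vq^v_x-p^v_xq^v)+p^v_xq^w-p^wq^v_x+3(p^w_xq^v-p^vq^w_x),\\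 &2u(p^uq^v_x-p^v_xq^u)+(8v+9w^2)(p^vq^v_x-p^v_xq^v)+4u_x(p^vq^u-p^uq^v)+2w(p^u_xq^u-p^uq^u_x)+9u(p^vq^u_x-p^u_xq^v)+p^w_xq^w-p^wq^w_x. \end{aligned}$$ A finite family of operators with a common domain $\Omega$ is called linear compatible if each of them, and each of their real linear combinations $A$, has an involutive image: $[A(\Omega),A(\Omega)]\subseteq A(\Omega)$. **(a)** On every open set $W$ the operators $A_0,\hat A_1,\hat A_2$ map $\mathrm{cosym}\,\mathcal E$ to $\mathrm{sym}\,\mathcal E$, the image of $A_0$ is involutive, and $A_0,\hat A_1,\hat A_2$ are linear compatible. **(b)** The open set $U=\{\det A_0\ne0\}$ is dense. Let $W\subseteq U$ be open and non-empty and $\omega=A_0^{-1}$ on $W$. Then $\omega$ maps $\mathrm{sym}\,\mathcal E$ to $\mathrm{cosym}\,\mathcal E$, the recursion operators $R_i=\hat A_i\circ\omega$ ($i=1,2$) map $\mathrm{sym}\,\mathcal E$ to itself, and $R_1,R_2$ are linear compatible on $\mathrm{sym}\,\mathcal E$. **(c)** For $W$ as in (b) define $$[\varphi,\psi]_{R_i}=\mathscr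 E_{R_i\varphi}(\psi)-\mathscr E_{R_i\psi}(\varphi)+A_0\bigl(\mathscr E_{R_i\varphi}(\omega)(\psi)-\mathscr E_{R_i\psi}(\omega)(\varphi)+\{\!\{\omega\varphi,\omega\psi\}\!\}_{\hat A_i}\bigr).$$ For all real $a,c_1,c_2$ put $[\,,]_{a,c}=a[\,,]+c_1[\,,]_{R_1}+c_2[\,,]_{R_2}$ and $R_{a,c}=a+c_1R_1+c_2R_2$. Then $[R_{a,c}\varphi,R_{a,c}\psi]=R_{a,c}([\varphi,\psi]_{a,c})$ for all triples $\varphi,\psi$ of differential functions, and $[\,,]_{a,c}$ is a Lie algebra structure on $\mathrm{sym}\,\mathcal E$. On $\mathrm{sym}\,\mathcal E$ the brackets $[\,,]_{R_1},[\,,]_{R_2}$ span a two-dimensional space, and $[\,,],[\,,]_{R_1},[\,,]_{R_2}$ are linearly independent. If $(c_1,c_2)\neq(0,0)$, then $[\,,]_{a,c}$ is a nontrivial deformation of $[\,,]$: there is no matrix operator $T$ in total derivatives (a finite sum $\sum_kT_kD_x^k$, with $3\times3$ matrices $T_k$ of differential functions on $W$) that maps $\mathrm{sym}\,\mathcal E$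 bijectively onto itself and satisfies $T([\varphi,\psi]_{a,c})=[T\varphi,T\psi]$ identically in arbitrary triples $\varphi,\psi$ of differential functions. -/

import Mathlib

open scoped ContDiff Topology
open TopologicalSpace (Opens)

noncomputable section

namespace DispersionlessBoussinesq

/-! ### Smooth differential functions on open subsets of the infinite jet space -/

/-- Coordinates on the infinite jet space: `x`, `t`, and `jet a k` for the `k`-th `x`-derivative of
the `a`-th dependent variable, where `(u, v, w)` are numbered `(0, 1, 2)`. In view of the evolution
equations these are also coordinates on the infinitely prolonged system. -/
inductive Coord : Type
  | x : Coord
  | t : Coord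
  | jet (a : Fin 3) (k : ℕ) : Coord
  deriving DecidableEq

/-- The infinite jet space, with the product (that is, inverse limit) topology. -/
abbrev JetSpace : Type := Coord → ℝ

/-- Projection of the jet space to finitely many coordinates. -/
def proj (s : Finset Coord) (y : JetSpace) : s → ℝ := fun c => y c

/-- `f` is a smooth function of finitely many jet coordinates on the open set `W`. -/
def IsDiffFun (W : Opens JetSpace) (f : W → ℝ) : Prop :=
  ∃ (s : Finset Coord) (g : (s → ℝ) → ℝ),
    ContDiffOn ℝ ∞ g (proj s '' (W : Set JetSpace)) ∧ ∀ y : W, f y = g (proj s y)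

/-- Extension of a function on `W` by zero. -/
def extZero (W : Opens JetSpace) (f : W → ℝ) (y : JetSpace) : ℝ :=
  open Classical in if h : y ∈ W then f ⟨y, h⟩ else 0

/-- The partial derivative of `f` with respect to the coordinate `c`. -/
def partialFun (W : Opens JetSpace) (c : Coord) (f : W → ℝ) (y : W) : ℝ :=
  deriv (fun r : ℝ => extZero W f (Function.update (y : JetSpace) c r)) ((y : JetSpace) c)

theorem isOpen_proj_image (s : Finset Coord) (W : Opens JetSpace) :
    IsOpen (proj s '' (W : Set JetSpace)) := by
  rw [isOpen_iff_mem_nhds]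
  rintro _ ⟨y, hy, rfl⟩
  let e : (s → ℝ) → JetSpace := fun z c => if h : c ∈ s then z ⟨c, h⟩ else y c
  have he : Continuous e := by
    refine continuous_pi fun c => ?_
    by_cases h : c ∈ s
    · simp only [e, h, dite_true]
      exact continuous_apply _
    · simp only [e, h, dite_false]
      exact continuous_const
  have hy' : e (proj s y) = y := by
    funext c
    simp [e, proj]
  have hpe : ∀ z, proj s (e z) = z := by
    intro z
    funext c
    simp [e, proj]
  have hmem : e ⁻¹' (W : Set JetSpace) ∈ 𝓝 (proj s y) := by
    apply (W.isOpen.preimage he).mem_nhds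
    simpa [hy'] using hy
  exact Filter.mem_of_superset hmem fun z hz => ⟨e z, hz, hpe z⟩

theorem hasDerivAt_slice {W : Opens JetSpace} {f : W → ℝ} {s : Finset Coord} {g : (s → ℝ) → ℝ}
    (hg : ContDiffOn ℝ ∞ g (proj s '' (W : Set JetSpace))) (hf : ∀ y : W, f y = g (proj s y))
    (c : Coord) (y : W) :
    HasDerivAt (fun r : ℝ => extZero W f (Function.update (y : JetSpace) c r))
      (fderiv ℝ g (proj s y) (proj s (Pi.single c 1))) ((y : JetSpace) c) := by
  have hmem : proj s '' (W : Set JetSpace) ∈ 𝓝 (proj s (y : JetSpace)) :=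
    (isOpen_proj_image s W).mem_nhds ⟨y, y.2, rfl⟩
  have hgd : DifferentiableAt ℝ g (proj s (y : JetSpace)) :=
    (hg.contDiffAt hmem).differentiableAt (by simp)
  have hup : HasDerivAt (fun r : ℝ => proj s (Function.update (y : JetSpace) c r))
      (proj s (Pi.single c 1)) ((y : JetSpace) c) := by
    rw [hasDerivAt_pi]
    intro i
    by_cases h : (i : Coord) = c
    · simp only [proj, h, Function.update_self, Pi.single_eq_same]
      exact hasDerivAt_id' _
    · simp only [proj, Function.update_of_ne h, Pi.single_eq_of_ne h]
      exact hasDerivAt_const _ _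
  have hself : Function.update (y : JetSpace) c ((y : JetSpace) c) = y := Function.update_eq_self _ _
  have hcomp : HasDerivAt (fun r : ℝ => g (proj s (Function.update (y : JetSpace) c r)))
      (fderiv ℝ g (proj s y) (proj s (Pi.single c 1))) ((y : JetSpace) c) := by
    have hgd' : HasFDerivAt g (fderiv ℝ g (proj s y))
        (proj s (Function.update (y : JetSpace) c ((y : JetSpace) c))) := by
      rw [hself]
      exact hgd.hasFDerivAt
    exact hgd'.comp_hasDerivAt _ hup
  refine hcomp.congr_of_eventuallyEq ?_
  have hcont : Continuous fun r : ℝ => Function.update (y : JetSpace) c r :=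
    continuous_const.update c continuous_id
  have hW : ∀ᶠ r in 𝓝 ((y : JetSpace) c), Function.update (y : JetSpace) c r ∈ W := by
    apply (W.isOpen.preimage hcont).mem_nhds
    simp
  filter_upwards [hW] with r hr
  simp only [extZero, hr, dite_true]
  exact hf ⟨_, hr⟩

theorem IsDiffFun.differentiableAt {W : Opens JetSpace} {f : W → ℝ} (hf : IsDiffFun W f)
    (c : Coord) (y : W) :
    DifferentiableAt ℝ (fun r : ℝ => extZero W f (Function.update (y : JetSpace) c r))
      ((y : JetSpace) c) := by
  obtain ⟨s, g, hg, h⟩ := hf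
  exact (hasDerivAt_slice hg h c y).differentiableAt

theorem IsDiffFun.partialFun {W : Opens JetSpace} {f : W → ℝ} (hf : IsDiffFun W f) (c : Coord) :
    IsDiffFun W (partialFun W c f) := by
  obtain ⟨s, g, hg, h⟩ := hf
  refine ⟨s, fun z => fderiv ℝ g z (proj s (Pi.single c 1)), ?_, fun y =>
    (hasDerivAt_slice hg h c y).deriv⟩
  exact (hg.fderiv_of_isOpen (isOpen_proj_image s W) (by simp)).clm_apply contDiffOn_const

theorem IsDiffFun.finite_partialFun {W : Opens JetSpace} {f : W → ℝ} (hf : IsDiffFun W f) :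
    {c : Coord | DispersionlessBoussinesq.partialFun W c f ≠ 0}.Finite := by
  obtain ⟨s, g, hg, h⟩ := hf
  refine s.finite_toSet.subset fun c hc => ?_
  by_contra hcs
  apply hc
  funext y
  have h0 : proj s (Pi.single c (1 : ℝ)) = 0 := by
    funext i
    have hi : (i : Coord) ≠ c := fun hic => hcs (by simp [← hic])
    simp [proj, hi]
  have h1 := (hasDerivAt_slice hg h c y).deriv
  rw [h0, map_zero] at h1
  exact h1

theorem isDiffFun_enlarge {W : Opens JetSpace} {f : W → ℝ} {s s' : Finset Coord} (hs : s ⊆ s')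
    {g : (s → ℝ) → ℝ} (hg : ContDiffOn ℝ ∞ g (proj s '' (W : Set JetSpace)))
    (hf : ∀ y : W, f y = g (proj s y)) :
    ∃ g' : (s' → ℝ) → ℝ, ContDiffOn ℝ ∞ g' (proj s' '' (W : Set JetSpace)) ∧
      ∀ y : W, f y = g' (proj s' y) := by
  refine ⟨fun z => g fun c => z ⟨c, hs c.2⟩, ?_, hf⟩
  refine hg.comp (t := proj s '' (W : Set JetSpace))
    (f := fun (z : s' → ℝ) (c : s) => z ⟨c, hs c.2⟩) ?_ ?_
  · exact (contDiff_pi.2 fun c => contDiff_apply ℝ ℝ _).contDiffOn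
  · rintro _ ⟨y, hy, rfl⟩
    exact ⟨y, hy, rfl⟩

theorem isDiffFun_const (W : Opens JetSpace) (r : ℝ) : IsDiffFun W fun _ => r :=
  ⟨∅, fun _ => r, contDiffOn_const, fun _ => rfl⟩

theorem IsDiffFun.add {W : Opens JetSpace} {f h : W → ℝ} (hf : IsDiffFun W f)
    (hh : IsDiffFun W h) : IsDiffFun W (f + h) := by
  obtain ⟨s, g, hg, h1⟩ := hf
  obtain ⟨s', g', hg', h2⟩ := hh
  obtain ⟨k, hk, h3⟩ := isDiffFun_enlarge (s' := s ∪ s') Finset.subset_union_left hg h1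
  obtain ⟨k', hk', h4⟩ := isDiffFun_enlarge (s' := s ∪ s') Finset.subset_union_right hg' h2
  exact ⟨s ∪ s', fun z => k z + k' z, hk.add hk', fun y => by simp [h3, h4]⟩

theorem IsDiffFun.mul {W : Opens JetSpace} {f h : W → ℝ} (hf : IsDiffFun W f)
    (hh : IsDiffFun W h) : IsDiffFun W (f * h) := by
  obtain ⟨s, g, hg, h1⟩ := hf
  obtain ⟨s', g', hg', h2⟩ := hh
  obtain ⟨k, hk, h3⟩ := isDiffFun_enlarge (s' := s ∪ s') Finset.subset_union_left hg h1
  obtain ⟨k', hk', h4⟩ := isDiffFun_enlarge (s' := s ∪ s') Finset.subset_union_right hg' h2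
  exact ⟨s ∪ s', fun z => k z * k' z, hk.mul hk', fun y => by simp [h3, h4]⟩

/-- The algebra of smooth differential functions on `W`. -/
def DiffFun (W : Opens JetSpace) : Subalgebra ℝ (W → ℝ) where
  carrier := {f | IsDiffFun W f}
  mul_mem' := IsDiffFun.mul
  add_mem' := IsDiffFun.add
  algebraMap_mem' := isDiffFun_const W

variable {W : Opens JetSpace}

/-- A jet coordinate as a differential function. -/
def coord (c : Coord) : DiffFun W :=
  ⟨fun y => (y : JetSpace) c, {c}, fun z => z ⟨c, Finset.mem_singleton_self c⟩,
    (contDiff_apply ℝ ℝ _).contDiffOn, fun _ => rfl⟩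

theorem extZero_coe (f : W → ℝ) (y : W) : extZero W f y = f y := by
  simp [extZero]

theorem extZero_add (f g : W → ℝ) (y : JetSpace) :
    extZero W (f + g) y = extZero W f y + extZero W g y := by
  by_cases h : y ∈ W <;> simp [extZero, h]

theorem extZero_mul (f g : W → ℝ) (y : JetSpace) :
    extZero W (f * g) y = extZero W f y * extZero W g y := by
  by_cases h : y ∈ W <;> simp [extZero, h]

theorem extZero_smul (r : ℝ) (f : W → ℝ) (y : JetSpace) :
    extZero W (r • f) y = r * extZero W f y := by
  by_cases h : y ∈ W <;> simp [extZero, h]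

/-- The partial derivative with respect to a jet coordinate, as a derivation. -/
def pd (c : Coord) : Derivation ℝ (DiffFun W) (DiffFun W) :=
  Derivation.mk'
    { toFun := fun f => ⟨partialFun W c f, IsDiffFun.partialFun f.2 c⟩
      map_add' := fun f g => by
        ext y
        change partialFun W c ((f : W → ℝ) + g) y = partialFun W c f y + partialFun W c g y
        simp only [partialFun, extZero_add]
        exact deriv_fun_add (IsDiffFun.differentiableAt f.2 c y)
          (IsDiffFun.differentiableAt g.2 c y)
      map_smul' := fun r f => by
        ext y
        change partialFun W c (r • (f : W → ℝ)) y = r * partialFun W c f y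
        simp only [partialFun, extZero_smul]
        exact deriv_const_mul r (IsDiffFun.differentiableAt f.2 c y) }
    (fun f g => by
      ext y
      change partialFun W c ((f : W → ℝ) * g) y =
        (f : W → ℝ) y * partialFun W c g y + (g : W → ℝ) y * partialFun W c f y
      simp only [partialFun, extZero_mul]
      rw [deriv_fun_mul (IsDiffFun.differentiableAt f.2 c y)
        (IsDiffFun.differentiableAt g.2 c y)]
      simp only [Function.update_eq_self, extZero_coe]
      ring)

theorem finite_pd (f : DiffFun W) : {c : Coord | pd c f ≠ 0}.Finite := by
  refine (IsDiffFun.finite_partialFun f.2).subset fun c hc h => hc (Subtype.ext h)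

theorem hasFiniteSupport_mul_pd (X : Coord → DiffFun W) (f : DiffFun W) :
    (Function.support fun c => X c * pd c f).Finite := by
  refine (finite_pd f).subset fun c hc h => hc ?_
  simp only [h, mul_zero]

/-- The vector field `∑ c, X c ∂/∂c` on the jet space, as a derivation of differential functions;
the sum is finite on each differential function. -/
def vectorField (X : Coord → DiffFun W) : Derivation ℝ (DiffFun W) (DiffFun W) :=
  Derivation.mk'
    { toFun := fun f => ∑ᶠ c, X c * pd c f
      map_add' := fun f g => by
        rw [← finsum_add_distrib (hasFiniteSupport_mul_pd X f) (hasFiniteSupport_mul_pd X g)]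
        exact finsum_congr fun c => by rw [map_add, mul_add]
      map_smul' := fun r f => by
        rw [RingHom.id_apply, smul_finsum' r (hasFiniteSupport_mul_pd X f)]
        exact finsum_congr fun c => by rw [Derivation.map_smul, mul_smul_comm] }
    (fun f g => by
      change ∑ᶠ c, X c * pd c (f * g) = f * (∑ᶠ c, X c * pd c g) + g * (∑ᶠ c, X c * pd c f)
      rw [mul_finsum' _ _ (hasFiniteSupport_mul_pd X f), mul_finsum' _ _ (hasFiniteSupport_mul_pd X g),
        ← finsum_add_distrib]
      · refine finsum_congr fun c => ?_
        rw [Derivation.leibniz, smul_eq_mul, smul_eq_mul]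
        ring
      · refine (hasFiniteSupport_mul_pd X g).subset fun c hc h => hc ?_
        simp only [h, mul_zero]
      · refine (hasFiniteSupport_mul_pd X f).subset fun c hc h => hc ?_
        simp only [h, mul_zero])

/-! ### Total derivatives, evolutionary fields, symmetries and cosymmetries -/

/-- Triples of differential functions. -/
abbrev Sec (W : Opens JetSpace) : Type := Fin 3 → DiffFun W

/-- The total derivative `D_x = ∂_x + ∑ u^a_{k+1} ∂/∂u^a_k`. -/
def Dx : Derivation ℝ (DiffFun W) (DiffFun W) :=
  vectorField fun
    | .x => 1
    | .t => 0
    | .jet a k => coord (.jet a (k + 1))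

/-- The iterated total derivative `D_x ^ k`. -/
def DxPow (k : ℕ) : DiffFun W →ₗ[ℝ] DiffFun W :=
  (Dx : Derivation ℝ (DiffFun W) (DiffFun W)).toLinearMap ^ k

/-- The components `D_x ^ k (φ^a)` of the evolutionary vector field with section `φ`. -/
def evolCoeff (φ : Sec W) : Coord → DiffFun W
  | .x => 0
  | .t => 0
  | .jet a k => DxPow k (φ a)

/-- The evolutionary derivation `E_φ = ∑ D_x ^ k (φ^a) ∂/∂u^a_k`. -/
def evol (φ : Sec W) : Derivation ℝ (DiffFun W) (DiffFun W) :=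
  vectorField (evolCoeff φ)

/-- The evolutionary derivation acting componentwise on triples. -/
def evolSec (φ ψ : Sec W) : Sec W := fun i => evol φ (ψ i)

/-- The standard bracket `[φ, ψ] = E_φ(ψ) - E_ψ(φ)` of evolutionary vector fields. -/
def stdBracket (φ ψ : Sec W) : Sec W := evolSec φ ψ - evolSec ψ φ

-- The dependent variables and their first `x`-derivatives.
def u : DiffFun W := coord (.jet 0 0)
def v : DiffFun W := coord (.jet 1 0)
def w : DiffFun W := coord (.jet 2 0)
def ux : DiffFun W := coord (.jet 0 1)
def vx : DiffFun W := coord (.jet 1 1)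
def wx : DiffFun W := coord (.jet 2 1)

/-- The right-hand sides of `u_t = w w_x + v_x`, `v_t = -u w_x - 3 u_x w`, `w_t = u_x`. -/
def rhs : Sec W := ![w * wx + vx, -u * wx - 3 * ux * w, ux]

/-- The total derivative `D_t`, restricted to the system. -/
def Dt : Derivation ℝ (DiffFun W) (DiffFun W) :=
  vectorField fun
    | .x => 0
    | .t => 1
    | .jet a k => DxPow k (rhs a)

theorem evol_add (φ ψ : Sec W) (f : DiffFun W) : evol (φ + ψ) f = evol φ f + evol ψ f := by
  change ∑ᶠ c, evolCoeff (φ + ψ) c * pd c f =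
    (∑ᶠ c, evolCoeff φ c * pd c f) + ∑ᶠ c, evolCoeff ψ c * pd c f
  rw [← finsum_add_distrib (hasFiniteSupport_mul_pd _ f) (hasFiniteSupport_mul_pd _ f)]
  refine finsum_congr fun c => ?_
  rw [← add_mul]
  cases c <;> simp [evolCoeff]

theorem evol_smul (r : ℝ) (φ : Sec W) (f : DiffFun W) : evol (r • φ) f = r • evol φ f := by
  change ∑ᶠ c, evolCoeff (r • φ) c * pd c f = r • ∑ᶠ c, evolCoeff φ c * pd c f
  rw [smul_finsum' r (hasFiniteSupport_mul_pd _ f)]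
  refine finsum_congr fun c => ?_
  rw [← smul_mul_assoc]
  cases c <;> simp [evolCoeff]

/-- The symmetries `φ` of the system on `W`: the solutions of the linearized system
`D_t φ = E_φ(rhs)`. -/
def symmetries (W : Opens JetSpace) : Submodule ℝ (Sec W) where
  carrier := {φ | ∀ i, Dt (φ i) = evol φ (rhs i)}
  add_mem' := fun {φ ψ} hφ hψ i => by
    rw [Pi.add_apply, map_add, evol_add, hφ i, hψ i]
  zero_mem' := fun i => by
    have h := evol_smul 0 (0 : Sec W) (rhs i)
    rw [zero_smul, zero_smul] at h
    rw [h, Pi.zero_apply, map_zero]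
  smul_mem' := fun r φ hφ i => by
    rw [Pi.smul_apply, Derivation.map_smul, evol_smul, hφ i]

/-- The `a`-th component of the formal adjoint of the linearization of `rhs`, applied to `ψ`:
`∑ b, ∑ k, (-D_x) ^ k (∂ rhs^b / ∂u^a_k * ψ_b)`. -/
def adjointLin (ψ : Sec W) (a : Fin 3) : DiffFun W :=
  ∑ b, ∑ᶠ k : ℕ, (-1 : ℝ) ^ k • DxPow k (pd (.jet a k) (rhs b) * ψ b)

theorem finite_adjointLin_support (ψ : Sec W) (a b : Fin 3) :
    (Function.support fun k : ℕ =>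
      (-1 : ℝ) ^ k • DxPow k (pd (.jet a k) (rhs b) * ψ b)).Finite := by
  have hinj : Function.Injective fun k : ℕ => Coord.jet a k := fun k l h => by
    simpa using h
  refine ((finite_pd (rhs b : DiffFun W)).preimage hinj.injOn).subset fun k hk h => hk ?_
  simp only [h, zero_mul, map_zero, smul_zero]

theorem adjointLin_add (φ ψ : Sec W) (a : Fin 3) :
    adjointLin (φ + ψ) a = adjointLin φ a + adjointLin ψ a := by
  simp only [adjointLin]
  rw [← Finset.sum_add_distrib]
  refine Finset.sum_congr rfl fun b _ => ?_
  rw [← finsum_add_distrib (finite_adjointLin_support φ a b) (finite_adjointLin_support ψ a b)]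
  refine finsum_congr fun k => ?_
  rw [Pi.add_apply, mul_add, map_add, smul_add]

theorem adjointLin_smul (r : ℝ) (ψ : Sec W) (a : Fin 3) :
    adjointLin (r • ψ) a = r • adjointLin ψ a := by
  simp only [adjointLin]
  rw [Finset.smul_sum]
  refine Finset.sum_congr rfl fun b _ => ?_
  rw [smul_finsum' r (finite_adjointLin_support ψ a b)]
  refine finsum_congr fun k => ?_
  rw [Pi.smul_apply, mul_smul_comm, map_smul, smul_comm]

/-- The cosymmetries `ψ` of the system on `W`: the solutions of the adjoint linearized system. -/
def cosymmetries (W : Opens JetSpace) : Submodule ℝ (Sec W) where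
  carrier := {ψ | ∀ a, Dt (ψ a) + adjointLin ψ a = 0}
  add_mem' := fun {φ ψ} hφ hψ a => by
    rw [Pi.add_apply, map_add, adjointLin_add, add_add_add_comm, hφ a, hψ a, add_zero]
  zero_mem' := fun a => by
    have h := adjointLin_smul 0 (0 : Sec W) a
    rw [zero_smul, zero_smul] at h
    rw [h, Pi.zero_apply, map_zero, add_zero]
  smul_mem' := fun r φ hφ a => by
    rw [Pi.smul_apply, Derivation.map_smul, adjointLin_smul, ← smul_add, hφ a, smul_zero]

/-! ### Matrix operators in total derivatives -/

/-- A matrix operator `∑ k, T_k D_x ^ k` in total derivatives, given by its coefficients. -/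
abbrev TDOp (W : Opens JetSpace) : Type := ℕ →₀ Matrix (Fin 3) (Fin 3) (DiffFun W)

/-- Multiplication of triples by a matrix of differential functions. -/
def mulMat (M : Matrix (Fin 3) (Fin 3) (DiffFun W)) : Sec W →ₗ[ℝ] Sec W :=
  (Matrix.mulVecLin M).restrictScalars ℝ

/-- The linear map `φ ↦ ∑ k, T_k (D_x ^ k φ)` defined by an operator in total derivatives. -/
def TDOp.toLin (T : TDOp W) : Sec W →ₗ[ℝ] Sec W :=
  ∑ k ∈ T.support, mulMat (T k) ∘ₗ (DxPow k).compLeft (Fin 3)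

/-- The operator `M₁ D_x + M₀`. -/
def firstOrder (M₁ M₀ : Matrix (Fin 3) (Fin 3) (DiffFun W)) : TDOp W :=
  Finsupp.single 1 M₁ + Finsupp.single 0 M₀

/-- The matrix of the zero-order Noether operator `A₀`, over any commutative ring. -/
def noetherMatrix {R : Type} [CommRing R] (u w ux vx wx : R) : Matrix (Fin 3) (Fin 3) R :=
  !![w * wx + vx, -3 * ux * w - u * wx, ux;
     -3 * ux * w - u * wx, -3 * w ^ 2 * wx - 4 * vx * w - u * ux, vx;
     ux, vx, wx]

/-- The coefficient matrix of `A₀`. -/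
def A₀mat : Matrix (Fin 3) (Fin 3) (DiffFun W) := noetherMatrix u w ux vx wx

/-- The zero-order Noether operator `A₀`. -/
def A₀ : TDOp W := Finsupp.single 0 A₀mat

/-- The first Hamiltonian operator. -/
def A₁ : TDOp W :=
  firstOrder
    !![1, 0, 0;
       0, -4 * w, 1;
       0, 1, 0]
    !![0, 0, 0;
       0, -2 * wx, 0;
       0, 0, 0]

/-- The function `h = -(3/2 u² + 8 v w + 3 w³)`. -/
def h : DiffFun W := -((3 / 2 : ℝ) • u ^ 2 + 8 * v * w + 3 * w ^ 3)

/-- The second Hamiltonian operator. -/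
def A₂ : TDOp W :=
  firstOrder
    !![2 * w ^ 2 + 4 * v, -11 * u * w, 3 * u;
       -11 * u * w, 2 * h, 4 * v;
       3 * u, 4 * v, 2 * w]
    !![2 * (w * wx + vx), -(5 * ux * w + 9 * u * wx), ux;
       -6 * ux * w - 2 * u * wx, Dx h, vx;
       2 * ux, 3 * vx, wx]

/-- The bi-differential bracket of `A₁`. -/
def ib₁ (p q : Sec W) : Sec W :=
  ![0, 0, 2 * (p 1 * Dx (q 1) - Dx (p 1) * q 1)]

/-- The bi-differential bracket of `A₂`. -/
def ib₂ (p q : Sec W) : Sec W :=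
  ![2 * (Dx (p 2) * q 0 - p 0 * Dx (q 2)) + 6 * w * (p 0 * Dx (q 1) - Dx (p 1) * q 0)
      + 5 * w * (p 1 * Dx (q 0) - Dx (p 0) * q 1) + Dx (p 0) * q 2 - p 2 * Dx (q 0)
      + 4 * wx * (p 0 * q 1 - p 1 * q 0) + 3 * u * (p 1 * Dx (q 1) - Dx (p 1) * q 1),
    2 * (Dx (p 0) * q 0 - p 0 * Dx (q 0)) + 8 * w * (p 1 * Dx (q 1) - Dx (p 1) * q 1)
      + Dx (p 1) * q 2 - p 2 * Dx (q 1) + 3 * (Dx (p 2) * q 1 - p 1 * Dx (q 2)),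
    2 * u * (p 0 * Dx (q 1) - Dx (p 1) * q 0)
      + (8 * v + 9 * w ^ 2) * (p 1 * Dx (q 1) - Dx (p 1) * q 1)
      + 4 * ux * (p 1 * q 0 - p 0 * q 1) + 2 * w * (Dx (p 0) * q 0 - p 0 * Dx (q 0))
      + 9 * u * (p 1 * Dx (q 0) - Dx (p 0) * q 1) + Dx (p 2) * q 2 - p 2 * Dx (q 2)]

/-! ### Involutivity, linear compatibility, recursion operators and deformed brackets -/

/-- The image of `A` on the domain `Ω` is closed under the standard bracket. -/
def HasInvolutiveImage (Ω : Submodule ℝ (Sec W)) (A : Sec W →ₗ[ℝ] Sec W) : Prop :=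
  ∀ p ∈ Ω, ∀ q ∈ Ω, ∃ r ∈ Ω, stdBracket (A p) (A q) = A r

/-- Operators with the common domain `Ω` and involutive images are linear compatible if all their
real linear combinations have involutive images. -/
def LinearCompatible {N : ℕ} (Ω : Submodule ℝ (Sec W)) (A : Fin N → Sec W →ₗ[ℝ] Sec W) : Prop :=
  (∀ i, HasInvolutiveImage Ω (A i)) ∧
    ∀ c : Fin N → ℝ, HasInvolutiveImage Ω (∑ i, c i • A i)

theorem continuous_det_noetherMatrix : Continuous fun y : JetSpace =>
    (noetherMatrix (y (.jet 0 0)) (y (.jet 2 0))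
      (y (.jet 0 1)) (y (.jet 1 1)) (y (.jet 2 1))).det := by
  simp only [noetherMatrix, Matrix.det_fin_three, Matrix.of_apply, Matrix.cons_val]
  fun_prop

/-- The open set of jets where the matrix `A₀` is invertible. -/
def regularJets : Opens JetSpace where
  carrier := {y | (noetherMatrix (y (.jet 0 0)) (y (.jet 2 0))
    (y (.jet 0 1)) (y (.jet 1 1)) (y (.jet 2 1))).det ≠ 0}
  is_open' := isOpen_ne_fun continuous_det_noetherMatrix continuous_const

/-- The matrix `A₀⁻¹`; it is the inverse of `A₀` whenever `W` lies in `regularJets`. -/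
def A₀inv : Matrix (Fin 3) (Fin 3) (DiffFun W) := A₀mat⁻¹

/-- The two Hamiltonian operators. -/
def ham : Fin 2 → TDOp W := ![A₁, A₂]

/-- Their bi-differential brackets. -/
def hamIb : Fin 2 → Sec W → Sec W → Sec W := ![ib₁, ib₂]

/-- The recursion operators, `A₁ ∘ A₀⁻¹` and `A₂ ∘ A₀⁻¹`. -/
def recOp (i : Fin 2) : Sec W →ₗ[ℝ] Sec W := (ham i).toLin ∘ₗ mulMat A₀inv

/-- The bi-differential bracket of a recursion operator, by the chain rule:
`A₀ (E_{Rφ}(ω)(ψ) - E_{Rψ}(ω)(φ) + {{ω φ, ω ψ}})` with `ω = A₀⁻¹`. -/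
def recIb (i : Fin 2) (φ ψ : Sec W) : Sec W :=
  mulMat A₀mat (mulMat (A₀inv.map (evol (recOp i φ))) ψ - mulMat (A₀inv.map (evol (recOp i ψ))) φ
    + hamIb i (mulMat A₀inv φ) (mulMat A₀inv ψ))

/-- The bracket `[φ, ψ]_R = E_{Rφ}(ψ) - E_{Rψ}(φ) + {{φ, ψ}}_R` of a recursion operator. -/
def recBracket (i : Fin 2) (φ ψ : Sec W) : Sec W :=
  evolSec (recOp i φ) ψ - evolSec (recOp i ψ) φ + recIb i φ ψ

/-- The linear combination `a [ , ] + c₀ [ , ]_{R₁} + c₁ [ , ]_{R₂}`. -/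
def deformedBracket (a : ℝ) (c : Fin 2 → ℝ) (φ ψ : Sec W) : Sec W :=
  a • stdBracket φ ψ + ∑ i, c i • recBracket i φ ψ

/-- `b` restricts to a real Lie algebra structure on the subspace `S`. -/
structure IsLieBracketOn (S : Submodule ℝ (Sec W)) (b : Sec W → Sec W → Sec W) : Prop where
  mem : ∀ φ ∈ S, ∀ ψ ∈ S, b φ ψ ∈ S
  add_left : ∀ φ ∈ S, ∀ ψ ∈ S, ∀ χ ∈ S, b (φ + ψ) χ = b φ χ + b ψ χ
  add_right : ∀ φ ∈ S, ∀ ψ ∈ S, ∀ χ ∈ S, b φ (ψ + χ) = b φ ψ + b φ χ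
  smul_left : ∀ r : ℝ, ∀ φ ∈ S, ∀ ψ ∈ S, b (r • φ) ψ = r • b φ ψ
  smul_right : ∀ r : ℝ, ∀ φ ∈ S, ∀ ψ ∈ S, b φ (r • ψ) = r • b φ ψ
  self : ∀ φ ∈ S, b φ φ = 0
  jacobi : ∀ φ ∈ S, ∀ ψ ∈ S, ∀ χ ∈ S, b φ (b ψ χ) + b ψ (b χ φ) + b χ (b φ ψ) = 0

/-- The restriction of a bracket to the symmetries. -/
def onSym (b : Sec W → Sec W → Sec W) : symmetries W → symmetries W → Sec W :=
  fun φ ψ => b φ ψ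

/-- The bracket `b` is trivial (conjugate to the standard one): `b φ ψ = T⁻¹ [T φ, T ψ]` for an
operator `T` in total derivatives that maps the symmetries bijectively onto themselves. As for all
bi-differential brackets, the relation is an identity in arbitrary sections. -/
def IsTrivialDeformation (b : Sec W → Sec W → Sec W) : Prop :=
  ∃ T : TDOp W,
    Set.BijOn T.toLin (symmetries W : Set (Sec W)) (symmetries W : Set (Sec W)) ∧
      ∀ φ ψ : Sec W, T.toLin (b φ ψ) = stdBracket (T.toLin φ) (T.toLin ψ)

end DispersionlessBoussinesq

end

open scoped ContDiff Topology
open TopologicalSpace (Opens)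

noncomputable section

set_option linter.unusedSimpArgs false

namespace DispersionlessBoussinesq

variable {W : Opens JetSpace}

/-! ### Calculus of differential functions -/

/-! The algebraic claims reduce to finitely many differential-polynomial identities, transported
through A₀; nontriviality is a separate argument by localization at a point and comparison of
leading terms.

Besides the two given brackets there is a bracket `ib₀` for A₀. Put [[p,q]]_i = E_{A_i p} q - E_{A_i
q} p + {{p,q}}_i (`domBracket`). For arbitrary triples the polarized relation [A_i p, A_j q] + [A_j
p, A_i q] = A_i [[p,q]]_j + A_j [[p,q]]_i holds (`stdBracket_noether`): the terms differentiating p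
and q cancel, and the derivatives of the coefficients are compared by expansion. A quadratic form
depends only on the symmetrization of its coefficients, so every combination Σ c_i A_i intertwines Σ
c_i [[,]]_i with the standard bracket. Each [[,]]_i preserves cosymmetries (`domBracket_mem`), which
gives the compatibility in (a). The Jacobi identity is verified in the same polarized way
(`domBracket_jacobi`); it cannot be pulled back along the operators, which may have a kernel (A₁
kills constants such as (1,0,0)).

Where A₀ is invertible, φ = A₀ p identifies symmetries with cosymmetries, R_i with A_i, and
[,]_{a,c} with a [[,]]_0 + c₁ [[,]]_1 + c₂ [[,]]_2 (`deformedBracket_A₀`). Hence (b), the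
intertwining relation and the Lie structure in (c). Linear independence is tested on the dilation
cosymmetry (t,0,x) against three others.

For nontriviality, let T intertwine [,]_{a,c} with [,]. Take ψ flat at a point y, that is, with all
its total x-derivatives zero at y. Modulo flat sections T[φ,ψ]_{a,c} is T(E_{R_{a,c}φ} ψ), while
[Tφ,Tψ] is T(E_{Tφ} ψ). So T ∘ E_χ sends flat sections to flat sections for χ = R_{a,c}φ - Tφ, and
suitable test sections ψ force χ = 0 (`eq_zero_of_toLin_evolSec_mem_flatSec`). Thus T = R_{a,c}, and
surjectivity of T puts the dilation symmetry A₀(t,0,x) in the image of a A₀ + c₁ A₁ + c₂ A₂. This is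
impossible (`noetherComb_ne_dilation`): the operator is hydrodynamic, free of x and has a
nondegenerate leading matrix, so a preimage would have order zero and be independent of x, whereas
the coefficients of A₀(t,0,x) contain x. -/

theorem pd_apply_eq {f : DiffFun W} {s : Finset Coord} {g : (s → ℝ) → ℝ}
    (hg : ContDiffOn ℝ ∞ g (proj s '' (W : Set JetSpace)))
    (hf : ∀ y : W, (f : W → ℝ) y = g (proj s y)) (c : Coord) (y : W) :
    (pd c f : W → ℝ) y = fderiv ℝ g (proj s y) (proj s (Pi.single c 1)) :=
  (hasDerivAt_slice hg hf c y).deriv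

/-- Locally f is a smooth function g of finitely many coordinates on an open set, so both sides are
values of the second derivative of g, which is symmetric. -/
theorem pd_comm (c d : Coord) (f : DiffFun W) : pd c (pd d f) = pd d (pd c f) := by
  obtain ⟨s, g, hg, hf⟩ := f.2
  have hopen := isOpen_proj_image s W
  have key : ∀ (c d : Coord) (y : W), (pd c (pd d f) : W → ℝ) y =
      fderiv ℝ (fderiv ℝ g) (proj s y) (proj s (Pi.single c 1)) (proj s (Pi.single d 1)) := by
    intro c d y
    have hg' : ContDiffOn ℝ ∞ (fderiv ℝ g) (proj s '' (W : Set JetSpace)) :=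
      hg.fderiv_of_isOpen hopen (by simp)
    rw [pd_apply_eq (g := fun z => fderiv ℝ g z (proj s (Pi.single d 1)))
      (hg'.clm_apply contDiffOn_const) (pd_apply_eq hg hf d)]
    have hd : DifferentiableAt ℝ (fderiv ℝ g) (proj s (y : JetSpace)) :=
      (hg'.contDiffAt (hopen.mem_nhds ⟨y, y.2, rfl⟩)).differentiableAt (by simp)
    rw [fderiv_clm_apply hd (differentiableAt_const _)]
    simp
  ext y
  rw [key, key]
  exact ((hg.contDiffAt (hopen.mem_nhds ⟨y, y.2, rfl⟩)).isSymmSndFDerivAt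
    (by
      rw [minSmoothness_of_isRCLikeNormedField]; exact ENat.LEInfty.out)).eq _ _

theorem pd_coord_self (c : Coord) : pd c (coord c : DiffFun W) = 1 := by
  ext y
  rw [pd_apply_eq (f := coord c) (s := {c}) (g := fun z => z ⟨c, Finset.mem_singleton_self c⟩)
    (contDiff_apply ℝ ℝ _).contDiffOn (fun _ => rfl)]
  have : fderiv ℝ (fun z : (({c} : Finset Coord) → ℝ) => z ⟨c, Finset.mem_singleton_self c⟩)
      (proj {c} (y : JetSpace)) =
        ContinuousLinearMap.proj (R := ℝ) (φ := fun _ => ℝ) ⟨c, Finset.mem_singleton_self c⟩ :=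
    (ContinuousLinearMap.proj (R := ℝ) (φ := fun _ : ({c} : Finset Coord) => ℝ)
      ⟨c, Finset.mem_singleton_self c⟩).fderiv
  rw [this]
  simp [proj]

theorem pd_coord_of_ne {c d : Coord} (hcd : c ≠ d) : pd c (coord d : DiffFun W) = 0 := by
  ext y
  rw [pd_apply_eq (f := coord d) (s := {d}) (g := fun z => z ⟨d, Finset.mem_singleton_self d⟩)
    (contDiff_apply ℝ ℝ _).contDiffOn (fun _ => rfl)]
  have : fderiv ℝ (fun z : (({d} : Finset Coord) → ℝ) => z ⟨d, Finset.mem_singleton_self d⟩)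
      (proj {d} (y : JetSpace)) =
        ContinuousLinearMap.proj (R := ℝ) (φ := fun _ => ℝ) ⟨d, Finset.mem_singleton_self d⟩ :=
    (ContinuousLinearMap.proj (R := ℝ) (φ := fun _ : ({d} : Finset Coord) => ℝ)
      ⟨d, Finset.mem_singleton_self d⟩).fderiv
  rw [this]
  simp [proj, hcd.symm]

theorem pd_coord (c d : Coord) : pd c (coord d : DiffFun W) = if c = d then 1 else 0 := by
  split_ifs with hcd
  · rw [hcd, pd_coord_self]
  · exact pd_coord_of_ne hcd

theorem vectorField_apply (X : Coord → DiffFun W) (f : DiffFun W) :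
    vectorField X f = ∑ᶠ c, X c * pd c f := rfl

theorem vectorField_eq_sum (X : Coord → DiffFun W) {f : DiffFun W} {s : Finset Coord}
    (hs : ∀ c ∉ s, pd c f = 0) : vectorField X f = ∑ c ∈ s, X c * pd c f := by
  rw [vectorField_apply]
  refine finsum_eq_sum_of_support_subset _ fun c hc => ?_
  by_contra hcs
  exact hc (by simp only [hs c hcs, mul_zero])

@[simp]
theorem vectorField_coord (X : Coord → DiffFun W) (c : Coord) :
    vectorField X (coord c) = X c := by
  rw [vectorField_eq_sum X (s := {c}) fun d hd => pd_coord_of_ne (by simpa using hd)]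
  rw [Finset.sum_singleton, pd_coord_self, mul_one]

/-- The commutator of two vector fields. -/
theorem vectorField_comm (X Y : Coord → DiffFun W) (f : DiffFun W) :
    vectorField X (vectorField Y f) - vectorField Y (vectorField X f) =
      vectorField (fun c => vectorField X (Y c) - vectorField Y (X c)) f := by
  classical
  set s := (finite_pd f).toFinset with hs_def
  have hs : ∀ c ∉ s, pd c f = 0 := fun c hc => by
    rwa [hs_def, Set.Finite.mem_toFinset, Set.mem_ofPred_eq, not_not] at hc
  have hs2 : ∀ d, ∀ c ∉ s, pd c (pd d f) = 0 := fun d c hc => by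
    rw [pd_comm, hs c hc, map_zero]
  -- The second sum is the second-order part; it is symmetric under exchange of X and Y because
  -- partial derivatives commute, so it drops out of the commutator.
  have key : ∀ X Y : Coord → DiffFun W, vectorField X (vectorField Y f) =
      (∑ c ∈ s, vectorField X (Y c) * pd c f) +
        ∑ c ∈ s, ∑ d ∈ s, Y c * X d * pd c (pd d f) := by
    intro X Y
    rw [vectorField_eq_sum Y hs, map_sum, ← Finset.sum_add_distrib]
    refine Finset.sum_congr rfl fun c _ => ?_
    rw [Derivation.leibniz, smul_eq_mul, smul_eq_mul, vectorField_eq_sum X (hs2 c),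
      Finset.mul_sum, add_comm, mul_comm]
    refine congrArg₂ _ rfl (Finset.sum_congr rfl fun d _ => ?_)
    rw [pd_comm d c, mul_assoc]
  rw [key X Y, key Y X, vectorField_eq_sum _ hs, Finset.sum_comm (f := fun c d =>
    X c * Y d * pd c (pd d f))]
  have : ∀ c d, X d * Y c * pd d (pd c f) = Y c * X d * pd c (pd d f) := fun c d => by
    rw [pd_comm d c, mul_comm (X d)]
  simp only [this, sub_mul, Finset.sum_sub_distrib]
  ring

theorem DxPow_zero (f : DiffFun W) : DxPow 0 f = f := rfl

theorem DxPow_succ (k : ℕ) (f : DiffFun W) : DxPow (k + 1) f = Dx (DxPow k f) := by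
  rw [DxPow, pow_succ']
  rfl

theorem DxPow_one (f : DiffFun W) : DxPow 1 f = Dx f := DxPow_succ 0 f

theorem DxPow_succ' (k : ℕ) (f : DiffFun W) : DxPow (k + 1) f = DxPow k (Dx f) := by
  rw [DxPow, pow_succ]
  rfl

@[simp]
theorem Dx_coord_x : Dx (coord .x : DiffFun W) = 1 := vectorField_coord _ _

@[simp]
theorem Dx_coord_t : Dx (coord .t : DiffFun W) = 0 := vectorField_coord _ _

@[simp]
theorem Dx_coord_jet (a : Fin 3) (k : ℕ) :
    Dx (coord (.jet a k) : DiffFun W) = coord (.jet a (k + 1)) := vectorField_coord _ _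

@[simp]
theorem evol_coord_x (φ : Sec W) : evol φ (coord .x : DiffFun W) = 0 := vectorField_coord _ _

@[simp]
theorem evol_coord_t (φ : Sec W) : evol φ (coord .t : DiffFun W) = 0 := vectorField_coord _ _

@[simp]
theorem evol_coord_jet (φ : Sec W) (a : Fin 3) (k : ℕ) :
    evol φ (coord (.jet a k) : DiffFun W) = DxPow k (φ a) := vectorField_coord _ _

@[simp]
theorem Dt_coord_x : Dt (coord .x : DiffFun W) = 0 := vectorField_coord _ _

@[simp]
theorem Dt_coord_t : Dt (coord .t : DiffFun W) = 1 := vectorField_coord _ _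

@[simp]
theorem Dt_coord_jet (a : Fin 3) (k : ℕ) :
    Dt (coord (.jet a k) : DiffFun W) = DxPow k (rhs a) := vectorField_coord _ _

/-- A commutator of vector fields is a vector field, determined by its values on coordinates. All
commutation rules for D_x, D_t and evolutionary derivations follow from this. -/
theorem vectorField_comm_eq_zero {X Y : Coord → DiffFun W}
    (hXY : ∀ c, vectorField X (Y c) = vectorField Y (X c)) (f : DiffFun W) :
    vectorField X (vectorField Y f) = vectorField Y (vectorField X f) := by
  rw [← sub_eq_zero, vectorField_comm]
  simp only [hXY, sub_self]
  rw [vectorField_apply]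
  simp

/-- Total and evolutionary derivatives commute. -/
theorem evol_Dx (φ : Sec W) (f : DiffFun W) : evol φ (Dx f) = Dx (evol φ f) := by
  refine vectorField_comm_eq_zero (fun c => ?_) f
  change evol φ _ = Dx _
  cases c with
  | x => simp [evolCoeff]
  | t => simp [evolCoeff]
  | jet a k => simp [evolCoeff, DxPow_succ]

theorem Dt_Dx (f : DiffFun W) : Dt (Dx f) = Dx (Dt f) := by
  refine vectorField_comm_eq_zero (fun c => ?_) f
  change Dt _ = Dx _
  cases c with
  | x => simp
  | t => simp
  | jet a k => simp [DxPow_succ]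

theorem evol_DxPow (φ : Sec W) (k : ℕ) (f : DiffFun W) :
    evol φ (DxPow k f) = DxPow k (evol φ f) := by
  induction k with
  | zero => rfl
  | succ k ih => rw [DxPow_succ, evol_Dx, ih, DxPow_succ]

theorem Dt_DxPow (k : ℕ) (f : DiffFun W) : Dt (DxPow k f) = DxPow k (Dt f) := by
  induction k with
  | zero => rfl
  | succ k ih => rw [DxPow_succ, Dt_Dx, ih, DxPow_succ]

/-- Evolutionary derivations form a Lie algebra. -/
theorem evol_stdBracket (φ ψ : Sec W) (f : DiffFun W) :
    evol (stdBracket φ ψ) f = evol φ (evol ψ f) - evol ψ (evol φ f) := by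
  refine Eq.symm ((vectorField_comm _ _ f).trans ?_)
  change vectorField _ f = vectorField _ f
  congr 2
  funext c
  change evol φ _ - evol ψ _ = _
  cases c with
  | x => simp [evolCoeff]
  | t => simp [evolCoeff]
  | jet a k =>
    simp only [evolCoeff, evol_DxPow, stdBracket, evolSec, Pi.sub_apply, map_sub]

/-- Symmetries commute with the total `t`-derivative. -/
theorem Dt_evol {φ : Sec W} (hφ : φ ∈ symmetries W) (f : DiffFun W) :
    Dt (evol φ f) = evol φ (Dt f) := by
  refine vectorField_comm_eq_zero (fun c => ?_) f
  change Dt _ = evol φ _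
  cases c with
  | x => simp [evolCoeff]
  | t => simp [evolCoeff]
  | jet a k => simp only [evolCoeff, evol_DxPow, Dt_DxPow, hφ a]

/-- Differential functions are continuous. -/
theorem DiffFun.continuous (f : DiffFun W) : Continuous (f : W → ℝ) := by
  obtain ⟨s, g, hg, hf⟩ := f.2
  have hp : Continuous fun y : W => proj s (y : JetSpace) :=
    continuous_pi fun c => (continuous_apply (c : Coord)).comp continuous_subtype_val
  rw [show (f : W → ℝ) = fun y : W => g (proj s y) from funext hf]
  exact hg.continuousOn.comp_continuous hp fun y => ⟨y, y.2, rfl⟩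

/-- A differential function without zeros is invertible. -/
theorem DiffFun.isUnit_of_ne_zero (f : DiffFun W) (hf : ∀ y, (f : W → ℝ) y ≠ 0) : IsUnit f := by
  obtain ⟨s, g, hg, hfg⟩ := f.2
  have hinv : IsDiffFun W fun y => ((f : W → ℝ) y)⁻¹ := by
    refine ⟨s, fun z => (g z)⁻¹, hg.inv ?_, fun y => congrArg _ (hfg y)⟩
    rintro _ ⟨y, hy, rfl⟩
    rw [← hfg ⟨y, hy⟩]
    exact hf _
  refine IsUnit.of_mul_eq_one ⟨_, hinv⟩ ?_
  ext y
  exact mul_inv_cancel₀ (hf y)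

/-! ### Explicit formulas -/

theorem derivation_mul (D : Derivation ℝ (DiffFun W) (DiffFun W)) (f g : DiffFun W) :
    D (f * g) = D f * g + f * D g := by
  rw [Derivation.leibniz, smul_eq_mul, smul_eq_mul]
  ring

theorem derivation_ofNat (D : Derivation ℝ (DiffFun W) (DiffFun W)) (n : ℕ) [n.AtLeastTwo] :
    D (ofNat(n) : DiffFun W) = 0 :=
  D.map_natCast n

theorem derivation_sq (D : Derivation ℝ (DiffFun W) (DiffFun W)) (f : DiffFun W) :
    D (f ^ 2) = 2 * f * D f := by
  rw [pow_two, derivation_mul]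
  ring

theorem derivation_cube (D : Derivation ℝ (DiffFun W) (DiffFun W)) (f : DiffFun W) :
    D (f ^ 3) = 3 * f ^ 2 * D f := by
  rw [pow_succ, derivation_mul, derivation_sq]
  ring

theorem Dx_u : Dx (u : DiffFun W) = ux := Dx_coord_jet 0 0
theorem Dx_v : Dx (v : DiffFun W) = vx := Dx_coord_jet 1 0
theorem Dx_w : Dx (w : DiffFun W) = wx := Dx_coord_jet 2 0

theorem evol_u (φ : Sec W) : evol φ u = φ 0 := evol_coord_jet φ 0 0
theorem evol_v (φ : Sec W) : evol φ v = φ 1 := evol_coord_jet φ 1 0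
theorem evol_w (φ : Sec W) : evol φ w = φ 2 := evol_coord_jet φ 2 0
theorem evol_ux (φ : Sec W) : evol φ ux = Dx (φ 0) := by
  rw [← Dx_u, evol_Dx, evol_u]
theorem evol_vx (φ : Sec W) : evol φ vx = Dx (φ 1) := by
  rw [← Dx_v, evol_Dx, evol_v]
theorem evol_wx (φ : Sec W) : evol φ wx = Dx (φ 2) := by
  rw [← Dx_w, evol_Dx, evol_w]

theorem rhs_zero : (rhs 0 : DiffFun W) = w * wx + vx := rfl
theorem rhs_one : (rhs 1 : DiffFun W) = -u * wx - 3 * ux * w := rfl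
theorem rhs_two : (rhs 2 : DiffFun W) = ux := rfl

theorem Dt_u : Dt (u : DiffFun W) = w * wx + vx := Dt_coord_jet 0 0
theorem Dt_v : Dt (v : DiffFun W) = -u * wx - 3 * ux * w := Dt_coord_jet 1 0
theorem Dt_w : Dt (w : DiffFun W) = ux := Dt_coord_jet 2 0
theorem Dt_ux : Dt (ux : DiffFun W) = Dx (w * wx + vx) := by
  rw [← Dx_u, Dt_Dx, Dt_u]
theorem Dt_vx : Dt (vx : DiffFun W) = Dx (-u * wx - 3 * ux * w) := by
  rw [← Dx_v, Dt_Dx, Dt_v]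
theorem Dt_wx : Dt (wx : DiffFun W) = Dx ux := by
  rw [← Dx_w, Dt_Dx, Dt_w]

/-- Doubling clears the denominator of h, so that its derivatives come from identities with integer
coefficients. -/
theorem two_mul_h : 2 * (h : DiffFun W) = -(3 * u ^ 2 + 16 * v * w + 6 * w ^ 3) := by
  have h32 : (2 : DiffFun W) * ((3 / 2 : ℝ) • u ^ 2) = 3 * u ^ 2 := by
    rw [mul_smul_comm, ← smul_mul_assoc, ← map_ofNat (algebraMap ℝ (DiffFun W)) 2,
      ← algebraMap_smul (DiffFun W) (3 / 2 : ℝ), smul_eq_mul, ← map_mul,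
      ← map_ofNat (algebraMap ℝ (DiffFun W)) 3]
    norm_num
  rw [h]
  linear_combination -h32

theorem two_mul_cancel {f g : DiffFun W} (hfg : 2 * f = 2 * g) : f = g := by
  ext y
  have := congrFun (congrArg Subtype.val hfg) y
  exact mul_left_cancel₀ (two_ne_zero (α := ℝ)) this

theorem derivation_h (D : Derivation ℝ (DiffFun W) (DiffFun W)) :
    D h = -(3 * u * D u + 8 * (D v * w + v * D w) + 9 * w ^ 2 * D w) := by
  apply two_mul_cancel
  have := congrArg D (two_mul_h (W := W))
  simp only [derivation_mul, derivation_ofNat, derivation_sq, derivation_cube, map_neg, map_add]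
    at this
  linear_combination this

theorem toLin_single (k : ℕ) (M : Matrix (Fin 3) (Fin 3) (DiffFun W)) :
    TDOp.toLin (Finsupp.single k M) = mulMat M ∘ₗ (DxPow k).compLeft (Fin 3) := by
  by_cases hM : M = 0
  · subst hM
    ext φ
    simp [TDOp.toLin, mulMat]
  · rw [TDOp.toLin, Finsupp.support_single k hM]
    simp

theorem mulMat_zero : mulMat (0 : Matrix (Fin 3) (Fin 3) (DiffFun W)) = 0 := by
  ext φ
  simp [mulMat]

theorem mulMat_add (M N : Matrix (Fin 3) (Fin 3) (DiffFun W)) :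
    mulMat (M + N) = mulMat M + mulMat N := by
  ext φ
  simp [mulMat]

theorem toLin_add (S T : TDOp W) : TDOp.toLin (S + T) = S.toLin + T.toLin :=
  Finsupp.sum_add_index' (h := fun k M => mulMat M ∘ₗ (DxPow k).compLeft (Fin 3))
    (fun k => by rw [mulMat_zero, LinearMap.zero_comp])
    (fun k M N => by rw [mulMat_add, LinearMap.add_comp])

theorem mulMat_apply (M : Matrix (Fin 3) (Fin 3) (DiffFun W)) (φ : Sec W) (i : Fin 3) :
    mulMat M φ i = M i 0 * φ 0 + M i 1 * φ 1 + M i 2 * φ 2 := by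
  simp [mulMat, Matrix.mulVec, dotProduct, Fin.sum_univ_three]

theorem firstOrder_apply (M N : Matrix (Fin 3) (Fin 3) (DiffFun W)) (φ : Sec W) (i : Fin 3) :
    (firstOrder M N).toLin φ i = M i 0 * Dx (φ 0) + M i 1 * Dx (φ 1) + M i 2 * Dx (φ 2) +
      (N i 0 * φ 0 + N i 1 * φ 1 + N i 2 * φ 2) := by
  rw [firstOrder, toLin_add, toLin_single, toLin_single, LinearMap.add_apply, Pi.add_apply,
    LinearMap.comp_apply, LinearMap.comp_apply, mulMat_apply, mulMat_apply]
  rfl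

theorem A₀_toLin : A₀.toLin = mulMat (A₀mat : Matrix (Fin 3) (Fin 3) (DiffFun W)) := by
  rw [A₀, toLin_single]
  rfl

theorem A₀_apply (p : Sec W) : A₀.toLin p =
    ![(w * wx + vx) * p 0 + (-3 * ux * w - u * wx) * p 1 + ux * p 2,
      (-3 * ux * w - u * wx) * p 0 + (-3 * w ^ 2 * wx - 4 * vx * w - u * ux) * p 1 + vx * p 2,
      ux * p 0 + vx * p 1 + wx * p 2] := by
  rw [A₀_toLin]
  ext1 i
  rw [mulMat_apply]
  fin_cases i <;> rfl

theorem A₁_apply (p : Sec W) : A₁.toLin p =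
    ![Dx (p 0), -4 * w * Dx (p 1) - 2 * wx * p 1 + Dx (p 2), Dx (p 1)] := by
  ext1 i
  rw [A₁, firstOrder_apply]
  fin_cases i <;> simp [Matrix.of_apply, Matrix.cons_val]
  ring

theorem A₂_apply (p : Sec W) : A₂.toLin p =
    ![(2 * w ^ 2 + 4 * v) * Dx (p 0) - 11 * u * w * Dx (p 1) + 3 * u * Dx (p 2) +
        2 * (w * wx + vx) * p 0 - (5 * ux * w + 9 * u * wx) * p 1 + ux * p 2,
      -11 * u * w * Dx (p 0) - (3 * u ^ 2 + 16 * v * w + 6 * w ^ 3) * Dx (p 1) +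
        4 * v * Dx (p 2) - (6 * ux * w + 2 * u * wx) * p 0 -
        (3 * u * ux + 8 * (vx * w + v * wx) + 9 * w ^ 2 * wx) * p 1 + vx * p 2,
      3 * u * Dx (p 0) + 4 * v * Dx (p 1) + 2 * w * Dx (p 2) + 2 * ux * p 0 + 3 * vx * p 1 +
        wx * p 2] := by
  ext1 i
  rw [A₂, firstOrder_apply, two_mul_h, derivation_h, Dx_u, Dx_v, Dx_w]
  fin_cases i <;> simp only [Matrix.of_apply, Matrix.cons_val, Fin.isValue, Fin.zero_eta,
    Fin.mk_one, Fin.reduceFinMk] <;> ring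

theorem evol_rhs_zero (φ : Sec W) :
    evol φ (rhs 0) = φ 2 * wx + w * Dx (φ 2) + Dx (φ 1) := by
  simp only [rhs_zero, map_add, derivation_mul, evol_w, evol_wx, evol_vx]

theorem evol_rhs_one (φ : Sec W) :
    evol φ (rhs 1) = -φ 0 * wx - u * Dx (φ 2) - 3 * Dx (φ 0) * w - 3 * ux * φ 2 := by
  simp only [rhs_one, map_sub, map_neg, derivation_mul, derivation_ofNat, evol_u, evol_w, evol_wx,
    evol_ux]
  ring

theorem evol_rhs_two (φ : Sec W) : evol φ (rhs 2) = Dx (φ 0) := evol_ux φ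

theorem pd_jet_coord (a b : Fin 3) (k l : ℕ) : pd (.jet a k) (coord (.jet b l) : DiffFun W) =
    if a = b ∧ k = l then 1 else 0 := by
  rw [pd_coord]
  simp only [Coord.jet.injEq]

theorem finsum_adjointLin (ψ : Sec W) (a b : Fin 3)
    (hk : ∀ k, pd (.jet a (k + 2)) (rhs b : DiffFun W) = 0) :
    ∑ᶠ k : ℕ, (-1 : ℝ) ^ k • DxPow k (pd (.jet a k) (rhs b) * ψ b) =
      pd (.jet a 0) (rhs b) * ψ b - Dx (pd (.jet a 1) (rhs b) * ψ b) := by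
  rw [finsum_eq_sum_of_support_subset (s := Finset.range 2)]
  · simp only [Finset.sum_range_succ, Finset.sum_range_zero, DxPow_zero, DxPow_one, pow_zero,
      pow_one, one_smul, neg_smul]
    ring
  · intro k hk'
    by_contra hk2
    obtain ⟨l, rfl⟩ : ∃ l, k = l + 2 :=
      ⟨k - 2, by simp only [Finset.coe_range, Set.mem_Iio] at hk2; omega⟩
    exact hk' (by simp only [hk l, zero_mul, map_zero, smul_zero])

theorem pd_rhs (c : Coord) : ∀ b, pd c (rhs b : DiffFun W) =
    (![pd c w * wx + w * pd c wx + pd c vx,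
      -(pd c u * wx) - u * pd c wx - 3 * (pd c ux * w + ux * pd c w), pd c ux] : Sec W) b
  | 0 => by
    simp only [rhs_zero, map_add, derivation_mul, Matrix.cons_val]
  | 1 => by
    simp only [rhs_one, map_sub, map_neg, derivation_mul, derivation_ofNat, Matrix.cons_val]
    ring
  | 2 => by simp only [rhs_two, Matrix.cons_val]

theorem pd_jet_rhs_add_two (a b : Fin 3) (k : ℕ) :
    pd (.jet a (k + 2)) (rhs b : DiffFun W) = 0 := by
  rw [pd_rhs]
  simp only [u, w, ux, vx, wx, pd_jet_coord, Nat.add_eq_zero_iff, OfNat.ofNat_ne_zero,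
    Nat.reduceEqDiff, and_false, if_false, mul_zero, zero_mul, add_zero, sub_zero, neg_zero]
  fin_cases b <;> rfl

theorem adjointLin_eq (ψ : Sec W) : adjointLin ψ =
    ![-wx * ψ 1 + 3 * Dx (w * ψ 1) - Dx (ψ 2), -Dx (ψ 0),
      wx * ψ 0 - Dx (w * ψ 0) - 3 * ux * ψ 1 + Dx (u * ψ 1)] := by
  ext1 a
  rw [adjointLin, Fin.sum_univ_three, finsum_adjointLin ψ a 0 (pd_jet_rhs_add_two a 0),
    finsum_adjointLin ψ a 1 (pd_jet_rhs_add_two a 1),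
    finsum_adjointLin ψ a 2 (pd_jet_rhs_add_two a 2)]
  simp only [pd_rhs, u, w, ux, vx, wx,
    pd_jet_coord]
  fin_cases a <;> simp [derivation_ofNat] <;> ring

/-! ### Compatibility of the three operators -/

/-- The bi-differential bracket of `A₀`. -/
def ib₀ (p q : Sec W) : Sec W :=
  ![Dx (p 0) * q 2 - p 0 * Dx (q 2) + (Dx (p 2) * q 0 - p 2 * Dx (q 0)) -
      3 * w * (Dx (p 0) * q 1 - p 0 * Dx (q 1) + (Dx (p 1) * q 0 - p 1 * Dx (q 0))) -
      u * (Dx (p 1) * q 1 - p 1 * Dx (q 1)) + 2 * wx * (p 0 * q 1 - p 1 * q 0),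
    Dx (p 0) * q 0 - p 0 * Dx (q 0) +
      (Dx (p 1) * q 2 - p 1 * Dx (q 2) + (Dx (p 2) * q 1 - p 2 * Dx (q 1))) -
      4 * w * (Dx (p 1) * q 1 - p 1 * Dx (q 1)),
    Dx (p 2) * q 2 - p 2 * Dx (q 2) + w * (Dx (p 0) * q 0 - p 0 * Dx (q 0)) -
      u * (Dx (p 0) * q 1 - p 0 * Dx (q 1) + (Dx (p 1) * q 0 - p 1 * Dx (q 0))) -
      3 * w ^ 2 * (Dx (p 1) * q 1 - p 1 * Dx (q 1)) - 2 * ux * (p 0 * q 1 - p 1 * q 0)]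

/-- The derivative of `A₀ q` along `φ` with `q` kept fixed. -/
def var₀ (φ q : Sec W) : Sec W :=
  ![(φ 2 * wx + w * Dx (φ 2) + Dx (φ 1)) * q 0 -
      (3 * (Dx (φ 0) * w + ux * φ 2) + φ 0 * wx + u * Dx (φ 2)) * q 1 + Dx (φ 0) * q 2,
    -(3 * (Dx (φ 0) * w + ux * φ 2) + φ 0 * wx + u * Dx (φ 2)) * q 0 -
      (6 * w * φ 2 * wx + 3 * w ^ 2 * Dx (φ 2) + 4 * (Dx (φ 1) * w + vx * φ 2) + φ 0 * ux +
        u * Dx (φ 0)) * q 1 + Dx (φ 1) * q 2,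
    Dx (φ 0) * q 0 + Dx (φ 1) * q 1 + Dx (φ 2) * q 2]

/-- The derivative of `A₁ q` along `φ` with `q` kept fixed. -/
def var₁ (φ q : Sec W) : Sec W :=
  ![0, -4 * φ 2 * Dx (q 1) - 2 * Dx (φ 2) * q 1, 0]

/-- The derivative of `A₂ q` along `φ` with `q` kept fixed. -/
def var₂ (φ q : Sec W) : Sec W :=
  ![(4 * w * φ 2 + 4 * φ 1) * Dx (q 0) - 11 * (φ 0 * w + u * φ 2) * Dx (q 1) +
      3 * φ 0 * Dx (q 2) + 2 * (φ 2 * wx + w * Dx (φ 2) + Dx (φ 1)) * q 0 -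
      (5 * (Dx (φ 0) * w + ux * φ 2) + 9 * (φ 0 * wx + u * Dx (φ 2))) * q 1 + Dx (φ 0) * q 2,
    -11 * (φ 0 * w + u * φ 2) * Dx (q 0) -
      (6 * u * φ 0 + 16 * (φ 1 * w + v * φ 2) + 18 * w ^ 2 * φ 2) * Dx (q 1) +
      4 * φ 1 * Dx (q 2) -
      (6 * (Dx (φ 0) * w + ux * φ 2) + 2 * (φ 0 * wx + u * Dx (φ 2))) * q 0 -
      (3 * (φ 0 * ux + u * Dx (φ 0)) + 8 * (Dx (φ 1) * w + vx * φ 2 + φ 1 * wx + v * Dx (φ 2)) +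
        18 * w * φ 2 * wx + 9 * w ^ 2 * Dx (φ 2)) * q 1 + Dx (φ 1) * q 2,
    3 * φ 0 * Dx (q 0) + 4 * φ 1 * Dx (q 1) + 2 * φ 2 * Dx (q 2) + 2 * Dx (φ 0) * q 0 +
      3 * Dx (φ 1) * q 1 + Dx (φ 2) * q 2]

theorem evolSec_A₀ (φ q : Sec W) :
    evolSec φ (A₀.toLin q) = A₀.toLin (evolSec φ q) + var₀ φ q := by
  ext1 b
  simp only [A₀_apply, var₀, evolSec, Pi.add_apply]
  fin_cases b <;> simp only [Matrix.cons_val, Fin.isValue, Fin.zero_eta, Fin.mk_one,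
    Fin.reduceFinMk, derivation_mul, derivation_ofNat, derivation_sq, map_add, map_sub, map_neg,
    evol_u, evol_w, evol_ux, evol_vx, evol_wx] <;> ring

theorem evolSec_A₁ (φ q : Sec W) :
    evolSec φ (A₁.toLin q) = A₁.toLin (evolSec φ q) + var₁ φ q := by
  ext1 b
  simp only [A₁_apply, var₁, evolSec, Pi.add_apply]
  fin_cases b <;> simp only [Matrix.cons_val, Fin.isValue, Fin.zero_eta, Fin.mk_one,
    Fin.reduceFinMk, derivation_mul, derivation_ofNat, map_add, map_sub, map_neg,
    evol_w, evol_wx, evol_Dx] <;> ring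

theorem evolSec_A₂ (φ q : Sec W) :
    evolSec φ (A₂.toLin q) = A₂.toLin (evolSec φ q) + var₂ φ q := by
  ext1 b
  simp only [A₂_apply, var₂, evolSec, Pi.add_apply]
  fin_cases b <;> simp only [Matrix.cons_val, Fin.isValue, Fin.zero_eta, Fin.mk_one,
    Fin.reduceFinMk, derivation_mul, derivation_ofNat, derivation_sq, derivation_cube, map_add,
    map_sub, map_neg, evol_u, evol_v, evol_w, evol_ux, evol_vx, evol_wx, evol_Dx] <;> ring

set_option maxHeartbeats 1000000 in
-- This is what involutivity of the image of A₀ amounts to once the evolutionary derivatives of p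
-- and q have cancelled: a polynomial identity in jet coordinates and x-derivatives of p and q. As
-- A₀ is generically invertible, it determines `ib₀`.
theorem var_compat₀₀ (p q : Sec W) :
    var₀ (A₀.toLin p) q - var₀ (A₀.toLin q) p = A₀.toLin (ib₀ p q) := by
  simp only [A₀_apply, var₀, ib₀]
  ext1 b
  fin_cases b <;> simp only [Matrix.cons_val, Fin.isValue, Fin.zero_eta, Fin.mk_one,
    Fin.reduceFinMk, Pi.sub_apply, Pi.add_apply, derivation_mul, derivation_ofNat, derivation_sq,
    derivation_cube, map_add, map_sub, map_neg, map_zero, Dx_u, Dx_v, Dx_w] <;> ring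

theorem var_compat₁₁ (p q : Sec W) :
    var₁ (A₁.toLin p) q - var₁ (A₁.toLin q) p = A₁.toLin (ib₁ p q) := by
  simp only [A₁_apply, var₁, ib₁]
  ext1 b
  fin_cases b <;> simp only [Matrix.cons_val, Fin.isValue, Fin.zero_eta, Fin.mk_one,
    Fin.reduceFinMk, Pi.sub_apply, Pi.add_apply, derivation_mul, derivation_ofNat, derivation_sq,
    derivation_cube, map_add, map_sub, map_neg, map_zero, Dx_u, Dx_v, Dx_w] <;> ring

set_option maxHeartbeats 1000000 in
theorem var_compat₂₂ (p q : Sec W) :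
    var₂ (A₂.toLin p) q - var₂ (A₂.toLin q) p = A₂.toLin (ib₂ p q) := by
  simp only [A₂_apply, var₂, ib₂]
  ext1 b
  fin_cases b <;> simp only [Matrix.cons_val, Fin.isValue, Fin.zero_eta, Fin.mk_one,
    Fin.reduceFinMk, Pi.sub_apply, Pi.add_apply, derivation_mul, derivation_ofNat, derivation_sq,
    derivation_cube, map_add, map_sub, map_neg, map_zero, Dx_u, Dx_v, Dx_w] <;> ring

set_option maxHeartbeats 1000000 in
theorem var_compat₀₁ (p q : Sec W) :
    var₁ (A₀.toLin p) q - var₁ (A₀.toLin q) p + (var₀ (A₁.toLin p) q - var₀ (A₁.toLin q) p) =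
      A₀.toLin (ib₁ p q) + A₁.toLin (ib₀ p q) := by
  simp only [A₀_apply, A₁_apply, var₀, var₁, ib₀, ib₁]
  ext1 b
  fin_cases b <;> simp only [Matrix.cons_val, Fin.isValue, Fin.zero_eta, Fin.mk_one,
    Fin.reduceFinMk, Pi.sub_apply, Pi.add_apply, derivation_mul, derivation_ofNat, derivation_sq,
    derivation_cube, map_add, map_sub, map_neg, map_zero, Dx_u, Dx_v, Dx_w] <;> ring

set_option maxHeartbeats 1000000 in
theorem var_compat₀₂ (p q : Sec W) :
    var₂ (A₀.toLin p) q - var₂ (A₀.toLin q) p + (var₀ (A₂.toLin p) q - var₀ (A₂.toLin q) p) =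
      A₀.toLin (ib₂ p q) + A₂.toLin (ib₀ p q) := by
  simp only [A₀_apply, A₂_apply, var₀, var₂, ib₀, ib₂]
  ext1 b
  fin_cases b <;> simp only [Matrix.cons_val, Fin.isValue, Fin.zero_eta, Fin.mk_one,
    Fin.reduceFinMk, Pi.sub_apply, Pi.add_apply, derivation_mul, derivation_ofNat, derivation_sq,
    derivation_cube, map_add, map_sub, map_neg, map_zero, Dx_u, Dx_v, Dx_w] <;> ring

set_option maxHeartbeats 1000000 in
theorem var_compat₁₂ (p q : Sec W) :
    var₂ (A₁.toLin p) q - var₂ (A₁.toLin q) p + (var₁ (A₂.toLin p) q - var₁ (A₂.toLin q) p) =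
      A₁.toLin (ib₂ p q) + A₂.toLin (ib₁ p q) := by
  simp only [A₁_apply, A₂_apply, var₁, var₂, ib₁, ib₂]
  ext1 b
  fin_cases b <;> simp only [Matrix.cons_val, Fin.isValue, Fin.zero_eta, Fin.mk_one,
    Fin.reduceFinMk, Pi.sub_apply, Pi.add_apply, derivation_mul, derivation_ofNat, derivation_sq,
    derivation_cube, map_add, map_sub, map_neg, map_zero, Dx_u, Dx_v, Dx_w] <;> ring

/-- The three Noether operators. -/
def noether : Fin 3 → Sec W →ₗ[ℝ] Sec W := ![A₀.toLin, A₁.toLin, A₂.toLin]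

/-- The bi-differential brackets of the three Noether operators. -/
def noetherIb : Fin 3 → Sec W → Sec W → Sec W := ![ib₀, ib₁, ib₂]

/-- The derivatives of the coefficients of the three Noether operators. -/
def noetherVar : Fin 3 → Sec W → Sec W → Sec W := ![var₀, var₁, var₂]

theorem evolSec_noether (i : Fin 3) (φ q : Sec W) :
    evolSec φ (noether i q) = noether i (evolSec φ q) + noetherVar i φ q :=
  match i with
  | 0 => evolSec_A₀ φ q
  | 1 => evolSec_A₁ φ q
  | 2 => evolSec_A₂ φ q

/-- The relation is the polarization of the one for a single operator, hence exactly what linear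
combinations require. On the diagonal it is the single relation added to itself. -/
theorem noetherVar_compat (i j : Fin 3) (p q : Sec W) :
    noetherVar j (noether i p) q - noetherVar j (noether i q) p +
        (noetherVar i (noether j p) q - noetherVar i (noether j q) p) =
      noether i (noetherIb j p q) + noether j (noetherIb i p q) :=
  match i, j with
  | 0, 0 => congrArg₂ (· + ·) (var_compat₀₀ p q) (var_compat₀₀ p q)
  | 1, 1 => congrArg₂ (· + ·) (var_compat₁₁ p q) (var_compat₁₁ p q)
  | 2, 2 => congrArg₂ (· + ·) (var_compat₂₂ p q) (var_compat₂₂ p q)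
  | 0, 1 => var_compat₀₁ p q
  | 0, 2 => var_compat₀₂ p q
  | 1, 2 => var_compat₁₂ p q
  | 1, 0 => by rw [add_comm, add_comm (noether 1 _)]; exact var_compat₀₁ p q
  | 2, 0 => by rw [add_comm, add_comm (noether 2 _)]; exact var_compat₀₂ p q
  | 2, 1 => by rw [add_comm, add_comm (noether 2 _)]; exact var_compat₁₂ p q

/-- The bracket on the domain of a Noether operator `A` that `A` intertwines with the standard
bracket. -/
def domBracket (i : Fin 3) (p q : Sec W) : Sec W :=
  evolSec (noether i p) q - evolSec (noether i q) p + noetherIb i p q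

/-- The Noether operators are pairwise compatible. -/
theorem stdBracket_noether (i j : Fin 3) (p q : Sec W) :
    stdBracket (noether i p) (noether j q) + stdBracket (noether j p) (noether i q) =
      noether i (domBracket j p q) + noether j (domBracket i p q) := by
  -- The terms A_i(E_{A_j p} q) and their analogues occur on both sides and cancel; only the
  -- derivatives of the coefficients remain, and these are `key`.
  have key := noetherVar_compat i j p q
  simp only [stdBracket, domBracket, evolSec_noether, map_add, map_sub]
  rw [← sub_eq_zero] at key ⊢
  rw [← key]
  abel

/-! ### Symmetries and cosymmetries -/

theorem mem_symmetries_iff (φ : Sec W) : φ ∈ symmetries W ↔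
    Dt (φ 0) = φ 2 * wx + w * Dx (φ 2) + Dx (φ 1) ∧
    Dt (φ 1) = -φ 0 * wx - u * Dx (φ 2) - 3 * Dx (φ 0) * w - 3 * ux * φ 2 ∧
    Dt (φ 2) = Dx (φ 0) := by
  rw [← evol_rhs_zero, ← evol_rhs_one, ← evol_rhs_two]
  exact Fin.forall_fin_succ.trans (and_congr Iff.rfl Fin.forall_fin_two)

theorem mem_cosymmetries_iff (p : Sec W) : p ∈ cosymmetries W ↔
    Dt (p 0) = -(2 * wx * p 1 + 3 * w * Dx (p 1) - Dx (p 2)) ∧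
    Dt (p 1) = Dx (p 0) ∧
    Dt (p 2) = w * Dx (p 0) + 2 * ux * p 1 - u * Dx (p 1) := by
  have key : p ∈ cosymmetries W ↔ _ :=
    Fin.forall_fin_succ.trans (and_congr Iff.rfl Fin.forall_fin_two)
  rw [key]
  simp only [adjointLin_eq, Matrix.cons_val, Fin.isValue, Fin.succ_zero_eq_one,
    Fin.succ_one_eq_two, derivation_mul, Dx_u, Dx_w]
  constructor
  · rintro ⟨h0, h1, h2⟩
    exact ⟨by linear_combination h0, by linear_combination h1, by linear_combination h2⟩
  · rintro ⟨h0, h1, h2⟩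
    exact ⟨by linear_combination h0, by linear_combination h1, by linear_combination h2⟩

theorem A₀_mem_symmetries {p : Sec W} (hp : p ∈ cosymmetries W) :
    A₀.toLin p ∈ symmetries W := by
  obtain ⟨h0, h1, h2⟩ := (mem_cosymmetries_iff p).1 hp
  rw [mem_symmetries_iff, A₀_apply]
  refine ⟨?_, ?_, ?_⟩ <;> simp only [Matrix.cons_val, Fin.isValue, derivation_mul,
    derivation_ofNat, derivation_sq, map_add, map_sub, map_neg, Dx_u, Dx_v, Dx_w, Dt_u, Dt_v, Dt_w,
    Dt_ux, Dt_vx, Dt_wx, Dt_Dx, h0, h1, h2] <;> ring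

theorem A₁_mem_symmetries {p : Sec W} (hp : p ∈ cosymmetries W) :
    A₁.toLin p ∈ symmetries W := by
  obtain ⟨h0, h1, h2⟩ := (mem_cosymmetries_iff p).1 hp
  rw [mem_symmetries_iff, A₁_apply]
  refine ⟨?_, ?_, ?_⟩ <;> simp only [Matrix.cons_val, Fin.isValue, derivation_mul,
    derivation_ofNat, derivation_sq, map_add, map_sub, map_neg, Dx_u, Dx_v, Dx_w, Dt_u, Dt_v, Dt_w,
    Dt_ux, Dt_vx, Dt_wx, Dt_Dx, h0, h1, h2] <;> ring

set_option maxHeartbeats 1000000 in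
theorem A₂_mem_symmetries {p : Sec W} (hp : p ∈ cosymmetries W) :
    A₂.toLin p ∈ symmetries W := by
  obtain ⟨h0, h1, h2⟩ := (mem_cosymmetries_iff p).1 hp
  rw [mem_symmetries_iff, A₂_apply]
  refine ⟨?_, ?_, ?_⟩ <;> simp only [Matrix.cons_val, Fin.isValue, derivation_mul,
    derivation_ofNat, derivation_sq, derivation_cube, map_add, map_sub, map_neg, Dx_u, Dx_v, Dx_w,
    Dt_u, Dt_v, Dt_w, Dt_ux, Dt_vx, Dt_wx, Dt_Dx, h0, h1, h2] <;> ring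

theorem noether_mem_symmetries (i : Fin 3) {p : Sec W} (hp : p ∈ cosymmetries W) :
    noether i p ∈ symmetries W :=
  match i with
  | 0 => A₀_mem_symmetries hp
  | 1 => A₁_mem_symmetries hp
  | 2 => A₂_mem_symmetries hp

/-- Where `A₀` is invertible, it reflects symmetries. -/
theorem mem_cosymmetries_of_A₀_mem {p : Sec W}
    (hA : IsUnit (A₀mat : Matrix (Fin 3) (Fin 3) (DiffFun W)))
    (hp : A₀.toLin p ∈ symmetries W) : p ∈ cosymmetries W := by
  -- Here r is the defect of the cosymmetry equation at p. Identically in p, A₀ maps it to the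
  -- defect of the symmetry equation at A₀ p, so the hypothesis gives A₀ r = 0.
  set r : Sec W := fun a => Dt (p a) + adjointLin p a with hr
  suffices hr0 : A₀.toLin r = 0 by
    rw [A₀_toLin] at hr0
    have hinj : r = 0 := Matrix.mulVec_injective_of_isUnit hA
      (by rw [Matrix.mulVec_zero]; exact hr0)
    exact fun a => congrFun hinj a
  obtain ⟨h0, h1, h2⟩ := (mem_symmetries_iff _).1 hp
  simp only [A₀_apply, Matrix.cons_val, Fin.isValue, derivation_mul,
    derivation_ofNat, derivation_sq, map_add, map_sub, map_neg, Dx_u, Dx_v, Dx_w, Dt_u, Dt_v, Dt_w,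
    Dt_ux, Dt_vx, Dt_wx, Dt_Dx] at h0 h1 h2
  ext1 b
  simp only [A₀_apply, hr, adjointLin_eq]
  fin_cases b <;> simp only [Matrix.cons_val, Fin.isValue, Fin.zero_eta, Fin.mk_one,
    Fin.reduceFinMk, Pi.zero_apply, derivation_mul, Dx_u, Dx_w]
  · linear_combination h0
  · linear_combination h1
  · linear_combination h2

/-- Since A p is a symmetry, E_{A p} commutes with D_t and may be applied to the cosymmetry equation
of q. The result is that equation for E_{A p} q, up to the derivatives of its coefficients along A
p. The hypotheses `h0`, `h1`, `h2` say that the correction `ib` compensates these terms,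
antisymmetrized in p and q. -/
theorem domBracket_mem_of {A : Sec W →ₗ[ℝ] Sec W} {ib : Sec W → Sec W → Sec W} {p q : Sec W}
    (hA : ∀ p ∈ cosymmetries W, A p ∈ symmetries W)
    (hp : p ∈ cosymmetries W) (hq : q ∈ cosymmetries W)
    (h0 : Dt (ib p q 0) + (2 * wx * ib p q 1 + 3 * w * Dx (ib p q 1) - Dx (ib p q 2)) =
      2 * Dx (A p 2) * q 1 + 3 * A p 2 * Dx (q 1) -
        (2 * Dx (A q 2) * p 1 + 3 * A q 2 * Dx (p 1)))
    (h1 : Dt (ib p q 1) - Dx (ib p q 0) = 0)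
    (h2 : Dt (ib p q 2) - (w * Dx (ib p q 0) + 2 * ux * ib p q 1 - u * Dx (ib p q 1)) =
      A q 2 * Dx (p 0) + 2 * Dx (A q 0) * p 1 - A q 0 * Dx (p 1) -
        (A p 2 * Dx (q 0) + 2 * Dx (A p 0) * q 1 - A p 0 * Dx (q 1))) :
    evolSec (A p) q - evolSec (A q) p + ib p q ∈ cosymmetries W := by
  have hAp := hA p hp
  have hAq := hA q hq
  obtain ⟨p0, p1, p2⟩ := (mem_cosymmetries_iff p).1 hp
  obtain ⟨q0, q1, q2⟩ := (mem_cosymmetries_iff q).1 hq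
  rw [mem_cosymmetries_iff]
  simp only [Pi.add_apply, Pi.sub_apply, evolSec, map_add, map_sub, map_neg, Dt_evol hAp,
    Dt_evol hAq, p0, p1, p2, q0, q1, q2, derivation_mul, derivation_ofNat, evol_Dx, evol_u, evol_w,
    evol_ux, evol_wx]
  exact ⟨by linear_combination h0, by linear_combination h1, by linear_combination h2⟩

set_option maxHeartbeats 1000000 in
theorem domBracket_mem₀ {p q : Sec W} (hp : p ∈ cosymmetries W) (hq : q ∈ cosymmetries W) :
    evolSec (A₀.toLin p) q - evolSec (A₀.toLin q) p + ib₀ p q ∈ cosymmetries W := by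
  obtain ⟨p0, p1, p2⟩ := (mem_cosymmetries_iff p).1 hp
  obtain ⟨q0, q1, q2⟩ := (mem_cosymmetries_iff q).1 hq
  refine domBracket_mem_of (fun p hp => A₀_mem_symmetries hp) hp hq ?_ ?_ ?_ <;>
    simp only [A₀_apply, ib₀, Matrix.cons_val, Fin.isValue, derivation_mul, derivation_ofNat,
      derivation_sq, derivation_cube, map_add, map_sub, map_neg, map_zero, Dx_u, Dx_v, Dx_w,
      Dt_u, Dt_v, Dt_w, Dt_ux, Dt_vx, Dt_wx, Dt_Dx, p0, p1, p2, q0, q1, q2] <;> ring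

theorem domBracket_mem₁ {p q : Sec W} (hp : p ∈ cosymmetries W) (hq : q ∈ cosymmetries W) :
    evolSec (A₁.toLin p) q - evolSec (A₁.toLin q) p + ib₁ p q ∈ cosymmetries W := by
  obtain ⟨p0, p1, p2⟩ := (mem_cosymmetries_iff p).1 hp
  obtain ⟨q0, q1, q2⟩ := (mem_cosymmetries_iff q).1 hq
  refine domBracket_mem_of (fun p hp => A₁_mem_symmetries hp) hp hq ?_ ?_ ?_ <;>
    simp only [A₁_apply, ib₁, Matrix.cons_val, Fin.isValue, derivation_mul, derivation_ofNat,
      derivation_sq, derivation_cube, map_add, map_sub, map_neg, map_zero, Dx_u, Dx_v, Dx_w,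
      Dt_u, Dt_v, Dt_w, Dt_ux, Dt_vx, Dt_wx, Dt_Dx, p0, p1, p2, q0, q1, q2] <;> ring

set_option maxHeartbeats 1000000 in
theorem domBracket_mem₂ {p q : Sec W} (hp : p ∈ cosymmetries W) (hq : q ∈ cosymmetries W) :
    evolSec (A₂.toLin p) q - evolSec (A₂.toLin q) p + ib₂ p q ∈ cosymmetries W := by
  obtain ⟨p0, p1, p2⟩ := (mem_cosymmetries_iff p).1 hp
  obtain ⟨q0, q1, q2⟩ := (mem_cosymmetries_iff q).1 hq
  refine domBracket_mem_of (fun p hp => A₂_mem_symmetries hp) hp hq ?_ ?_ ?_ <;>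
    simp only [A₂_apply, ib₂, Matrix.cons_val, Fin.isValue, derivation_mul, derivation_ofNat,
      derivation_sq, derivation_cube, map_add, map_sub, map_neg, map_zero, Dx_u, Dx_v, Dx_w,
      Dt_u, Dt_v, Dt_w, Dt_ux, Dt_vx, Dt_wx, Dt_Dx, p0, p1, p2, q0, q1, q2] <;> ring

/-- The brackets on the domains preserve cosymmetries. -/
theorem domBracket_mem (i : Fin 3) {p q : Sec W} (hp : p ∈ cosymmetries W)
    (hq : q ∈ cosymmetries W) : domBracket i p q ∈ cosymmetries W :=
  match i with
  | 0 => domBracket_mem₀ hp hq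
  | 1 => domBracket_mem₁ hp hq
  | 2 => domBracket_mem₂ hp hq

/-! ### The Jacobi identity -/

/-- The derivative of `ib₀ p q` along `φ` with `p` and `q` kept fixed. -/
def ibVar₀ (φ p q : Sec W) : Sec W :=
  ![-3 * φ 2 * (Dx (p 0) * q 1 - p 0 * Dx (q 1) + (Dx (p 1) * q 0 - p 1 * Dx (q 0))) -
      φ 0 * (Dx (p 1) * q 1 - p 1 * Dx (q 1)) + 2 * Dx (φ 2) * (p 0 * q 1 - p 1 * q 0),
    -4 * φ 2 * (Dx (p 1) * q 1 - p 1 * Dx (q 1)),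
    φ 2 * (Dx (p 0) * q 0 - p 0 * Dx (q 0)) -
      φ 0 * (Dx (p 0) * q 1 - p 0 * Dx (q 1) + (Dx (p 1) * q 0 - p 1 * Dx (q 0))) -
      6 * w * φ 2 * (Dx (p 1) * q 1 - p 1 * Dx (q 1)) -
      2 * Dx (φ 0) * (p 0 * q 1 - p 1 * q 0)]

/-- The derivative of `ib₁ p q` along `φ` with `p` and `q` kept fixed. -/
def ibVar₁ (_ _ _ : Sec W) : Sec W := ![0, 0, 0]

/-- The derivative of `ib₂ p q` along `φ` with `p` and `q` kept fixed. -/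
def ibVar₂ (φ p q : Sec W) : Sec W :=
  ![6 * φ 2 * (p 0 * Dx (q 1) - Dx (p 1) * q 0) + 5 * φ 2 * (p 1 * Dx (q 0) - Dx (p 0) * q 1) +
      4 * Dx (φ 2) * (p 0 * q 1 - p 1 * q 0) + 3 * φ 0 * (p 1 * Dx (q 1) - Dx (p 1) * q 1),
    8 * φ 2 * (p 1 * Dx (q 1) - Dx (p 1) * q 1),
    2 * φ 0 * (p 0 * Dx (q 1) - Dx (p 1) * q 0) +
      (8 * φ 1 + 18 * w * φ 2) * (p 1 * Dx (q 1) - Dx (p 1) * q 1) +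
      4 * Dx (φ 0) * (p 1 * q 0 - p 0 * q 1) + 2 * φ 2 * (Dx (p 0) * q 0 - p 0 * Dx (q 0)) +
      9 * φ 0 * (p 1 * Dx (q 0) - Dx (p 0) * q 1)]

/-- The derivatives of the coefficients of the brackets. -/
def noetherIbVar : Fin 3 → Sec W → Sec W → Sec W → Sec W := ![ibVar₀, ibVar₁, ibVar₂]

theorem evolSec_ib₀ (φ p q : Sec W) : evolSec φ (ib₀ p q) =
    ib₀ (evolSec φ p) q + ib₀ p (evolSec φ q) + ibVar₀ φ p q := by
  ext1 b
  simp only [ib₀, ibVar₀, evolSec, Pi.add_apply]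
  fin_cases b <;> simp only [Matrix.cons_val, Fin.isValue, Fin.zero_eta, Fin.mk_one,
    Fin.reduceFinMk, derivation_mul, derivation_ofNat, derivation_sq, map_add, map_sub, map_neg,
    map_zero, evol_u, evol_v, evol_w, evol_ux, evol_wx, evol_Dx] <;> ring

theorem ib₀_swap (p q : Sec W) : ib₀ q p = -ib₀ p q := by
  ext1 b
  simp only [ib₀, Pi.neg_apply]
  fin_cases b <;> simp only [Matrix.cons_val, Fin.isValue, Fin.zero_eta, Fin.mk_one,
    Fin.reduceFinMk] <;> ring

theorem ib₀_add (p q r : Sec W) : ib₀ p (q + r) = ib₀ p q + ib₀ p r := by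
  ext1 b
  simp only [ib₀, Pi.add_apply, map_add]
  fin_cases b <;> simp only [Matrix.cons_val, Fin.isValue, Fin.zero_eta, Fin.mk_one,
    Fin.reduceFinMk] <;> ring

theorem ib₀_smul (c : ℝ) (p q : Sec W) : ib₀ p (c • q) = c • ib₀ p q := by
  ext1 b
  simp only [ib₀, Pi.smul_apply, Algebra.smul_def, derivation_mul, Derivation.map_algebraMap]
  fin_cases b <;> simp only [Matrix.cons_val, Fin.isValue, Fin.zero_eta, Fin.mk_one,
    Fin.reduceFinMk] <;> ring

theorem evolSec_ib₁ (φ p q : Sec W) : evolSec φ (ib₁ p q) =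
    ib₁ (evolSec φ p) q + ib₁ p (evolSec φ q) + ibVar₁ φ p q := by
  ext1 b
  simp only [ib₁, ibVar₁, evolSec, Pi.add_apply]
  fin_cases b <;> simp only [Matrix.cons_val, Fin.isValue, Fin.zero_eta, Fin.mk_one,
    Fin.reduceFinMk, derivation_mul, derivation_ofNat, derivation_sq, map_add, map_sub, map_neg,
    map_zero, evol_u, evol_v, evol_w, evol_ux, evol_wx, evol_Dx] <;> ring

theorem ib₁_swap (p q : Sec W) : ib₁ q p = -ib₁ p q := by
  ext1 b
  simp only [ib₁, Pi.neg_apply]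
  fin_cases b <;> simp only [Matrix.cons_val, Fin.isValue, Fin.zero_eta, Fin.mk_one,
    Fin.reduceFinMk] <;> ring

theorem ib₁_add (p q r : Sec W) : ib₁ p (q + r) = ib₁ p q + ib₁ p r := by
  ext1 b
  simp only [ib₁, Pi.add_apply, map_add]
  fin_cases b <;> simp only [Matrix.cons_val, Fin.isValue, Fin.zero_eta, Fin.mk_one,
    Fin.reduceFinMk] <;> ring

theorem ib₁_smul (c : ℝ) (p q : Sec W) : ib₁ p (c • q) = c • ib₁ p q := by
  ext1 b
  simp only [ib₁, Pi.smul_apply, Algebra.smul_def, derivation_mul, Derivation.map_algebraMap]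
  fin_cases b <;> simp only [Matrix.cons_val, Fin.isValue, Fin.zero_eta, Fin.mk_one,
    Fin.reduceFinMk] <;> ring

theorem evolSec_ib₂ (φ p q : Sec W) : evolSec φ (ib₂ p q) =
    ib₂ (evolSec φ p) q + ib₂ p (evolSec φ q) + ibVar₂ φ p q := by
  ext1 b
  simp only [ib₂, ibVar₂, evolSec, Pi.add_apply]
  fin_cases b <;> simp only [Matrix.cons_val, Fin.isValue, Fin.zero_eta, Fin.mk_one,
    Fin.reduceFinMk, derivation_mul, derivation_ofNat, derivation_sq, map_add, map_sub, map_neg,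
    map_zero, evol_u, evol_v, evol_w, evol_ux, evol_wx, evol_Dx] <;> ring

theorem ib₂_swap (p q : Sec W) : ib₂ q p = -ib₂ p q := by
  ext1 b
  simp only [ib₂, Pi.neg_apply]
  fin_cases b <;> simp only [Matrix.cons_val, Fin.isValue, Fin.zero_eta, Fin.mk_one,
    Fin.reduceFinMk] <;> ring

theorem ib₂_add (p q r : Sec W) : ib₂ p (q + r) = ib₂ p q + ib₂ p r := by
  ext1 b
  simp only [ib₂, Pi.add_apply, map_add]
  fin_cases b <;> simp only [Matrix.cons_val, Fin.isValue, Fin.zero_eta, Fin.mk_one,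
    Fin.reduceFinMk] <;> ring

theorem ib₂_smul (c : ℝ) (p q : Sec W) : ib₂ p (c • q) = c • ib₂ p q := by
  ext1 b
  simp only [ib₂, Pi.smul_apply, Algebra.smul_def, derivation_mul, Derivation.map_algebraMap]
  fin_cases b <;> simp only [Matrix.cons_val, Fin.isValue, Fin.zero_eta, Fin.mk_one,
    Fin.reduceFinMk] <;> ring

theorem evolSec_noetherIb (i : Fin 3) (φ p q : Sec W) : evolSec φ (noetherIb i p q) =
    noetherIb i (evolSec φ p) q + noetherIb i p (evolSec φ q) + noetherIbVar i φ p q :=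
  match i with
  | 0 => evolSec_ib₀ φ p q
  | 1 => evolSec_ib₁ φ p q
  | 2 => evolSec_ib₂ φ p q

theorem noetherIb_swap (i : Fin 3) (p q : Sec W) : noetherIb i q p = -noetherIb i p q :=
  match i with
  | 0 => ib₀_swap p q
  | 1 => ib₁_swap p q
  | 2 => ib₂_swap p q

theorem noetherIb_add (i : Fin 3) (p q r : Sec W) : noetherIb i p (q + r) =
    noetherIb i p q + noetherIb i p r :=
  match i with
  | 0 => ib₀_add p q r
  | 1 => ib₁_add p q r
  | 2 => ib₂_add p q r

theorem noetherIb_smul (i : Fin 3) (c : ℝ) (p q : Sec W) : noetherIb i p (c • q) =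
    c • noetherIb i p q :=
  match i with
  | 0 => ib₀_smul c p q
  | 1 => ib₁_smul c p q
  | 2 => ib₂_smul c p q

set_option maxHeartbeats 4000000 in
-- The part of the Jacobi identity that survives when all evolutionary derivatives of p, q, r have
-- cancelled; again a polynomial identity, valid for arbitrary triples.
theorem ib_jacobi₀₀ (p q r : Sec W) :
    ib₀ p (ib₀ q r) + ib₀ q (ib₀ r p) + ib₀ r (ib₀ p q) +
      (ibVar₀ (A₀.toLin p) q r + ibVar₀ (A₀.toLin q) r p + ibVar₀ (A₀.toLin r) p q) = 0 := by
  simp only [A₀_apply, ib₀, ibVar₀]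
  ext1 b
  fin_cases b <;> simp only [Matrix.cons_val, Fin.isValue, Fin.zero_eta, Fin.mk_one,
    Fin.reduceFinMk, Pi.zero_apply, Pi.add_apply, derivation_mul, derivation_ofNat,
    derivation_sq, derivation_cube, map_add, map_sub, map_neg, map_zero, Dx_u, Dx_v, Dx_w] <;> ring

set_option maxHeartbeats 4000000 in
theorem ib_jacobi₁₁ (p q r : Sec W) :
    ib₁ p (ib₁ q r) + ib₁ q (ib₁ r p) + ib₁ r (ib₁ p q) +
      (ibVar₁ (A₁.toLin p) q r + ibVar₁ (A₁.toLin q) r p + ibVar₁ (A₁.toLin r) p q) = 0 := by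
  simp only [A₁_apply, ib₁, ibVar₁]
  ext1 b
  fin_cases b <;> simp only [Matrix.cons_val, Fin.isValue, Fin.zero_eta, Fin.mk_one,
    Fin.reduceFinMk, Pi.zero_apply, Pi.add_apply, derivation_mul, derivation_ofNat,
    derivation_sq, derivation_cube, map_add, map_sub, map_neg, map_zero, Dx_u, Dx_v, Dx_w] <;> ring

set_option maxHeartbeats 4000000 in
theorem ib_jacobi₂₂ (p q r : Sec W) :
    ib₂ p (ib₂ q r) + ib₂ q (ib₂ r p) + ib₂ r (ib₂ p q) +
      (ibVar₂ (A₂.toLin p) q r + ibVar₂ (A₂.toLin q) r p + ibVar₂ (A₂.toLin r) p q) = 0 := by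
  simp only [A₂_apply, ib₂, ibVar₂]
  ext1 b
  fin_cases b <;> simp only [Matrix.cons_val, Fin.isValue, Fin.zero_eta, Fin.mk_one,
    Fin.reduceFinMk, Pi.zero_apply, Pi.add_apply, derivation_mul, derivation_ofNat,
    derivation_sq, derivation_cube, map_add, map_sub, map_neg, map_zero, Dx_u, Dx_v, Dx_w] <;> ring

set_option maxHeartbeats 4000000 in
theorem ib_jacobi₀₁ (p q r : Sec W) :
    ib₀ p (ib₁ q r) + ib₀ q (ib₁ r p) + ib₀ r (ib₁ p q) +
      (ibVar₁ (A₀.toLin p) q r + ibVar₁ (A₀.toLin q) r p + ibVar₁ (A₀.toLin r) p q) +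
      (ib₁ p (ib₀ q r) + ib₁ q (ib₀ r p) + ib₁ r (ib₀ p q) +
        (ibVar₀ (A₁.toLin p) q r + ibVar₀ (A₁.toLin q) r p +
          ibVar₀ (A₁.toLin r) p q)) = 0 := by
  simp only [A₀_apply, A₁_apply, ib₀, ib₁, ibVar₀, ibVar₁]
  ext1 b
  fin_cases b <;> simp only [Matrix.cons_val, Fin.isValue, Fin.zero_eta, Fin.mk_one,
    Fin.reduceFinMk, Pi.zero_apply, Pi.add_apply, derivation_mul, derivation_ofNat,
    derivation_sq, derivation_cube, map_add, map_sub, map_neg, map_zero, Dx_u, Dx_v, Dx_w] <;> ring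

set_option maxHeartbeats 4000000 in
theorem ib_jacobi₀₂ (p q r : Sec W) :
    ib₀ p (ib₂ q r) + ib₀ q (ib₂ r p) + ib₀ r (ib₂ p q) +
      (ibVar₂ (A₀.toLin p) q r + ibVar₂ (A₀.toLin q) r p + ibVar₂ (A₀.toLin r) p q) +
      (ib₂ p (ib₀ q r) + ib₂ q (ib₀ r p) + ib₂ r (ib₀ p q) +
        (ibVar₀ (A₂.toLin p) q r + ibVar₀ (A₂.toLin q) r p +
          ibVar₀ (A₂.toLin r) p q)) = 0 := by
  simp only [A₀_apply, A₂_apply, ib₀, ib₂, ibVar₀, ibVar₂]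
  ext1 b
  fin_cases b <;> simp only [Matrix.cons_val, Fin.isValue, Fin.zero_eta, Fin.mk_one,
    Fin.reduceFinMk, Pi.zero_apply, Pi.add_apply, derivation_mul, derivation_ofNat,
    derivation_sq, derivation_cube, map_add, map_sub, map_neg, map_zero, Dx_u, Dx_v, Dx_w] <;> ring

set_option maxHeartbeats 4000000 in
theorem ib_jacobi₁₂ (p q r : Sec W) :
    ib₁ p (ib₂ q r) + ib₁ q (ib₂ r p) + ib₁ r (ib₂ p q) +
      (ibVar₂ (A₁.toLin p) q r + ibVar₂ (A₁.toLin q) r p + ibVar₂ (A₁.toLin r) p q) +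
      (ib₂ p (ib₁ q r) + ib₂ q (ib₁ r p) + ib₂ r (ib₁ p q) +
        (ibVar₁ (A₂.toLin p) q r + ibVar₁ (A₂.toLin q) r p +
          ibVar₁ (A₂.toLin r) p q)) = 0 := by
  simp only [A₁_apply, A₂_apply, ib₁, ib₂, ibVar₁, ibVar₂]
  ext1 b
  fin_cases b <;> simp only [Matrix.cons_val, Fin.isValue, Fin.zero_eta, Fin.mk_one,
    Fin.reduceFinMk, Pi.zero_apply, Pi.add_apply, derivation_mul, derivation_ofNat,
    derivation_sq, derivation_cube, map_add, map_sub, map_neg, map_zero, Dx_u, Dx_v, Dx_w] <;> ring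

theorem noetherIb_jacobi (i j : Fin 3) (p q r : Sec W) :
    noetherIb i p (noetherIb j q r) + noetherIb i q (noetherIb j r p) +
        noetherIb i r (noetherIb j p q) +
        (noetherIbVar j (noether i p) q r + noetherIbVar j (noether i q) r p +
          noetherIbVar j (noether i r) p q) +
      (noetherIb j p (noetherIb i q r) + noetherIb j q (noetherIb i r p) +
        noetherIb j r (noetherIb i p q) +
        (noetherIbVar i (noether j p) q r + noetherIbVar i (noether j q) r p +
          noetherIbVar i (noether j r) p q)) = 0 :=
  match i, j with
  | 0, 0 => (congrArg₂ (· + ·) (ib_jacobi₀₀ p q r) (ib_jacobi₀₀ p q r)).trans (add_zero 0)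
  | 1, 1 => (congrArg₂ (· + ·) (ib_jacobi₁₁ p q r) (ib_jacobi₁₁ p q r)).trans (add_zero 0)
  | 2, 2 => (congrArg₂ (· + ·) (ib_jacobi₂₂ p q r) (ib_jacobi₂₂ p q r)).trans (add_zero 0)
  | 0, 1 => ib_jacobi₀₁ p q r
  | 0, 2 => ib_jacobi₀₂ p q r
  | 1, 2 => ib_jacobi₁₂ p q r
  | 1, 0 => (add_comm _ _).trans (ib_jacobi₀₁ p q r)
  | 2, 0 => (add_comm _ _).trans (ib_jacobi₀₂ p q r)
  | 2, 1 => (add_comm _ _).trans (ib_jacobi₁₂ p q r)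

/-! ### Linear combinations of the Noether operators -/

/-- The evolutionary derivation as a bilinear map. -/
def evolₗ : Sec W →ₗ[ℝ] Sec W →ₗ[ℝ] Sec W :=
  LinearMap.mk₂ ℝ evolSec (fun _ _ _ => funext fun _ => evol_add _ _ _)
    (fun _ _ _ => funext fun _ => evol_smul _ _ _)
    (fun φ _ _ => funext fun _ => map_add (evol φ) _ _)
    (fun _ φ _ => funext fun _ => (evol φ).map_smul _ _)

theorem evolₗ_apply (φ ψ : Sec W) : evolₗ φ ψ = evolSec φ ψ := rfl

/-- The standard bracket as a bilinear map. -/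
def stdBracketₗ : Sec W →ₗ[ℝ] Sec W →ₗ[ℝ] Sec W :=
  LinearMap.mk₂ ℝ stdBracket
    (fun _ _ _ => by simp only [stdBracket, ← evolₗ_apply, map_add, LinearMap.add_apply]; abel)
    (fun _ _ _ => by
      simp only [stdBracket, ← evolₗ_apply, map_smul, LinearMap.smul_apply, smul_sub])
    (fun _ _ _ => by simp only [stdBracket, ← evolₗ_apply, map_add, LinearMap.add_apply]; abel)
    (fun _ _ _ => by
      simp only [stdBracket, ← evolₗ_apply, map_smul, LinearMap.smul_apply, smul_sub])

theorem stdBracketₗ_apply (φ ψ : Sec W) : stdBracketₗ φ ψ = stdBracket φ ψ := rfl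

/-- The bi-differential brackets as bilinear maps. -/
def noetherIbₗ (i : Fin 3) : Sec W →ₗ[ℝ] Sec W →ₗ[ℝ] Sec W :=
  LinearMap.mk₂ ℝ (noetherIb i)
    (fun p q r => by
      rw [noetherIb_swap i r, noetherIb_add, noetherIb_swap i p, noetherIb_swap i q]; abel)
    (fun c p q => by rw [noetherIb_swap i q, noetherIb_smul, noetherIb_swap i p, smul_neg, neg_neg])
    (noetherIb_add i) (noetherIb_smul i)

theorem noetherIbₗ_apply (i : Fin 3) (p q : Sec W) : noetherIbₗ i p q = noetherIb i p q := rfl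

/-- The brackets on the domains of the Noether operators as bilinear maps. -/
def domBracketₗ (i : Fin 3) : Sec W →ₗ[ℝ] Sec W →ₗ[ℝ] Sec W :=
  LinearMap.mk₂ ℝ (domBracket i)
    (fun _ _ _ => by simp only [domBracket, ← evolₗ_apply, ← noetherIbₗ_apply, map_add, LinearMap.add_apply]; abel)
    (fun _ _ _ => by
      simp only [domBracket, ← evolₗ_apply, ← noetherIbₗ_apply, map_smul, LinearMap.smul_apply, smul_sub, smul_add])
    (fun _ _ _ => by simp only [domBracket, ← evolₗ_apply, ← noetherIbₗ_apply, map_add, LinearMap.add_apply]; abel)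
    (fun _ _ _ => by
      simp only [domBracket, ← evolₗ_apply, ← noetherIbₗ_apply, map_smul, LinearMap.smul_apply, smul_sub, smul_add])

theorem domBracketₗ_apply (i : Fin 3) (p q : Sec W) : domBracketₗ i p q = domBracket i p q := rfl

theorem domBracket_swap (i : Fin 3) (p q : Sec W) : domBracket i q p = -domBracket i p q := by
  rw [domBracket, domBracket, noetherIb_swap]
  abel

/-- The linear combination of the Noether operators with coefficients `c`. -/
def noetherComb (c : Fin 3 → ℝ) : Sec W →ₗ[ℝ] Sec W :=
  ∑ i, c i • (noether i : Sec W →ₗ[ℝ] Sec W)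

/-- The linear combination of the domain brackets with coefficients `c`. -/
def domBracketComb (c : Fin 3 → ℝ) : Sec W →ₗ[ℝ] Sec W →ₗ[ℝ] Sec W :=
  ∑ i, c i • (domBracketₗ i : Sec W →ₗ[ℝ] Sec W →ₗ[ℝ] Sec W)

theorem noetherComb_apply (c : Fin 3 → ℝ) (p : Sec W) :
    noetherComb c p = ∑ i, c i • noether i p := by
  simp only [noetherComb, LinearMap.sum_apply, LinearMap.smul_apply]

theorem domBracketComb_apply (c : Fin 3 → ℝ) (p q : Sec W) :
    domBracketComb c p q = ∑ i, c i • domBracket i p q := by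
  simp only [domBracketComb, LinearMap.sum_apply, LinearMap.smul_apply, domBracketₗ_apply]

/-- Two quadratic forms whose coefficients have the same symmetrization agree. -/
theorem sum_sum_smul_eq {M : Type*} [AddCommGroup M] [Module ℝ M] (c : Fin 3 → ℝ)
    {F G : Fin 3 → Fin 3 → M} (hFG : ∀ i j, F i j + F j i = G i j + G j i) :
    ∑ i, ∑ j, (c i * c j) • F i j = ∑ i, ∑ j, (c i * c j) • G i j := by
  -- Doubling the sum and exchanging the two indices in one copy replaces F by its symmetrization.
  have key : ∀ F : Fin 3 → Fin 3 → M, (2 : ℝ) • ∑ i, ∑ j, (c i * c j) • F i j =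
      ∑ i, ∑ j, (c i * c j) • (F i j + F j i) := by
    intro F
    simp only [smul_add, Finset.sum_add_distrib]
    rw [two_smul]
    refine congrArg₂ _ rfl ?_
    rw [Finset.sum_comm]
    refine Finset.sum_congr rfl fun i _ => Finset.sum_congr rfl fun j _ => ?_
    rw [mul_comm]
  refine smul_right_injective M (two_ne_zero (α := ℝ)) ?_
  change (2 : ℝ) • _ = (2 : ℝ) • _
  rw [key, key]
  simp only [hFG]

/-- Linear combinations of the Noether operators intertwine the brackets. -/
theorem stdBracket_noetherComb (c : Fin 3 → ℝ) (p q : Sec W) :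
    stdBracket (noetherComb c p) (noetherComb c q) = noetherComb c (domBracketComb c p q) := by
  have h1 : stdBracket (noetherComb c p) (noetherComb c q) =
      ∑ i, ∑ j, (c i * c j) • stdBracket (noether i p) (noether j q) := by
    rw [← stdBracketₗ_apply]
    simp only [noetherComb_apply, map_sum, map_smul, LinearMap.sum_apply, LinearMap.smul_apply,
      stdBracketₗ_apply, Finset.smul_sum, smul_smul]
    rw [Finset.sum_comm]
    exact Finset.sum_congr rfl fun i _ => Finset.sum_congr rfl fun j _ => by rw [mul_comm]
  have h2 : noetherComb c (domBracketComb c p q) =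
      ∑ i, ∑ j, (c i * c j) • noether i (domBracket j p q) := by
    simp only [noetherComb_apply, domBracketComb_apply, map_sum, map_smul, Finset.smul_sum,
      smul_smul]
    rw [Finset.sum_comm]
    exact Finset.sum_congr rfl fun i _ => Finset.sum_congr rfl fun j _ => by rw [mul_comm]
  rw [h1, h2]
  exact sum_sum_smul_eq c fun i j => stdBracket_noether i j p q

theorem domBracketComb_mem (c : Fin 3 → ℝ) {p q : Sec W} (hp : p ∈ cosymmetries W)
    (hq : q ∈ cosymmetries W) : domBracketComb c p q ∈ cosymmetries W := by
  rw [domBracketComb_apply]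
  exact Submodule.sum_mem _ fun i _ => Submodule.smul_mem _ _ (domBracket_mem i hp hq)

theorem hasInvolutiveImage_noetherComb (c : Fin 3 → ℝ) :
    HasInvolutiveImage (cosymmetries W) (noetherComb c) := fun p hp q hq =>
  ⟨_, domBracketComb_mem c hp hq, stdBracket_noetherComb c p q⟩

theorem noetherComb_single (i : Fin 3) :
    noetherComb (Pi.single i 1) = (noether i : Sec W →ₗ[ℝ] Sec W) := by
  rw [noetherComb, Finset.sum_eq_single i]
  · rw [Pi.single_eq_same, one_smul]
  · intro j _ hj
    rw [Pi.single_eq_of_ne hj, zero_smul]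
  · simp

theorem linearCompatible_noether :
    LinearCompatible (cosymmetries W) (noether : Fin 3 → Sec W →ₗ[ℝ] Sec W) :=
  ⟨fun i => noetherComb_single (W := W) i ▸ hasInvolutiveImage_noetherComb _,
    hasInvolutiveImage_noetherComb⟩

theorem evolSec_evolSec_sub (φ ψ p : Sec W) :
    evolSec (stdBracket φ ψ) p = evolSec φ (evolSec ψ p) - evolSec ψ (evolSec φ p) :=
  funext fun _ => evol_stdBracket _ _ _

/-- Three facts combine: evolutionary derivations form a Lie algebra, the operators are pairwise
compatible, and the brackets satisfy `noetherIb_jacobi`. Only the sum over both orders of i and j is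
used, which suffices for linear combinations. -/
theorem domBracket_jacobi (i j : Fin 3) (p q r : Sec W) :
    domBracket i p (domBracket j q r) + domBracket i q (domBracket j r p) +
        domBracket i r (domBracket j p q) +
      (domBracket j p (domBracket i q r) + domBracket j q (domBracket i r p) +
        domBracket j r (domBracket i p q)) = 0 := by
  -- Compatibility turns the sum of the two fields into a sum of standard brackets, which act on p
  -- as commutators.
  have hE : ∀ p q r : Sec W, evolSec (noether i (domBracket j q r)) p +
      evolSec (noether j (domBracket i q r)) p =
      evolSec (noether i q) (evolSec (noether j r) p) -
        evolSec (noether j r) (evolSec (noether i q) p) +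
      (evolSec (noether j q) (evolSec (noether i r) p) -
        evolSec (noether i r) (evolSec (noether j q) p)) := by
    intro p q r
    rw [← evolSec_evolSec_sub, ← evolSec_evolSec_sub]
    simp only [← evolₗ_apply, ← LinearMap.add_apply, ← map_add]
    rw [stdBracket_noether]
  -- Full expansion of one nested bracket. Antisymmetry is used to put the terms in an order in
  -- which the cyclic sum cancels termwise.
  have hK : ∀ i j : Fin 3, ∀ p q r : Sec W, domBracket i p (domBracket j q r) =
      evolSec (noether i p) (evolSec (noether j q) r) -
        evolSec (noether i p) (evolSec (noether j r) q) +
        (noetherIb j (evolSec (noether i p) q) r - noetherIb j (evolSec (noether i p) r) q +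
          noetherIbVar j (noether i p) q r) -
        evolSec (noether i (domBracket j q r)) p +
        (noetherIb i p (noetherIb j q r) - noetherIb i (evolSec (noether j q) r) p +
          noetherIb i (evolSec (noether j r) q) p) := by
    intro i j p q r
    have h1 : evolSec (noether i p) (domBracket j q r) =
        evolSec (noether i p) (evolSec (noether j q) r) -
        evolSec (noether i p) (evolSec (noether j r) q) +
        evolSec (noether i p) (noetherIb j q r) := by
      rw [domBracket, ← evolₗ_apply, map_add, map_sub]
      rfl
    have h2 : noetherIb i p (domBracket j q r) =
        noetherIb i p (evolSec (noether j q) r) - noetherIb i p (evolSec (noether j r) q) +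
          noetherIb i p (noetherIb j q r) := by
      change noetherIbₗ i p (domBracket j q r) = _
      rw [domBracket, map_add, map_sub]
      rfl
    rw [domBracket, h1, h2, evolSec_noetherIb, noetherIb_swap j _ q,
      noetherIb_swap i (evolSec (noether j q) r) p, noetherIb_swap i (evolSec (noether j r) q) p]
    abel
  have e1 := hE p q r
  have e2 := hE q r p
  have e3 := hE r p q
  have e4 := noetherIb_jacobi i j p q r
  rw [hK i j p q r, hK i j q r p, hK i j r p q, hK j i p q r, hK j i q r p, hK j i r p q]
  rw [← sub_eq_zero] at e1 e2 e3
  have := congrArg₂ (· - ·) e4 (congrArg₂ (· + ·) (congrArg₂ (· + ·) e1 e2) e3)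
  simp only [add_zero, sub_zero] at this
  rw [← this]
  abel

theorem domBracketComb_jacobi (c : Fin 3 → ℝ) (p q r : Sec W) :
    domBracketComb c p (domBracketComb c q r) + domBracketComb c q (domBracketComb c r p) +
      domBracketComb c r (domBracketComb c p q) = 0 := by
  have key : ∀ p q r : Sec W, domBracketComb c p (domBracketComb c q r) =
      ∑ i, ∑ j, (c i * c j) • domBracket i p (domBracket j q r) := by
    intro p q r
    rw [domBracketComb_apply]
    refine Finset.sum_congr rfl fun i _ => ?_
    rw [domBracketComb_apply, ← domBracketₗ_apply, map_sum, Finset.smul_sum]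
    refine Finset.sum_congr rfl fun j _ => ?_
    rw [map_smul, smul_smul, domBracketₗ_apply]
  rw [key, key, key]
  simp only [← Finset.sum_add_distrib, ← smul_add]
  rw [sum_sum_smul_eq c (G := fun _ _ => 0) fun i j => by
    rw [domBracket_jacobi, add_zero]]
  simp

/-! ### Regular jets -/

/-- Restricted to the line from y to z, P becomes a one-variable polynomial that is nonzero at the
parameter 1. It has finitely many roots, so points of the line outside the zero set accumulate at y,
the parameter 0. -/
theorem dense_eval_ne_zero {σ : Type*} (P : MvPolynomial σ ℝ) {z : σ → ℝ}
    (hz : MvPolynomial.eval z P ≠ 0) : Dense {y : σ → ℝ | MvPolynomial.eval y P ≠ 0} := by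
  intro y
  set q : Polynomial ℝ := MvPolynomial.aeval
    (fun c => Polynomial.C (y c) + Polynomial.X * Polynomial.C (z c - y c)) P with hq
  set γ : ℝ → σ → ℝ := fun r c => y c + r * (z c - y c) with hγ
  have heval : ∀ r, q.eval r = MvPolynomial.eval (γ r) P := by
    intro r
    have h : (Polynomial.aeval r).comp (MvPolynomial.aeval
        (fun c => Polynomial.C (y c) + Polynomial.X * Polynomial.C (z c - y c))) =
        (MvPolynomial.aeval (γ r) : MvPolynomial σ ℝ →ₐ[ℝ] ℝ) :=
      MvPolynomial.algHom_ext fun c => by simp [hγ]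
    rw [← Polynomial.coe_aeval_eq_eval, hq, ← AlgHom.comp_apply, h, MvPolynomial.aeval_eq_eval]
  have hq0 : q ≠ 0 := by
    intro h0
    have h1 := heval 1
    rw [h0, Polynomial.eval_zero] at h1
    apply hz
    rw [h1]
    congr 1
    simp [hγ]
  have hdense : Dense {r : ℝ | q.eval r ≠ 0} := by
    have : {r : ℝ | q.eval r ≠ 0} = {r : ℝ | q.IsRoot r}ᶜ := rfl
    rw [this]
    exact (Polynomial.finite_setOfPred_isRoot hq0).countable.dense_compl ℝ
  have hcont : Continuous γ := by fun_prop
  have h0 : γ 0 = y := by simp [hγ]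
  have := hcont.range_subset_closure_image_dense hdense ⟨0, rfl⟩
  rw [h0] at this
  refine closure_mono ?_ this
  rintro _ ⟨r, hr, rfl⟩
  rwa [Set.mem_ofPred_eq, ← heval]

/-- Evaluation of differential functions at a point. -/
def evalAt (y : W) : DiffFun W →ₐ[ℝ] ℝ := (Pi.evalAlgHom ℝ _ y).comp (DiffFun W).val

theorem evalAt_apply (y : W) (f : DiffFun W) : evalAt y f = (f : W → ℝ) y := rfl

theorem evalAt_coord (y : W) (c : Coord) : evalAt y (coord c) = (y : JetSpace) c := rfl

/-- Naturality in the ring lets one determinant be read as a polynomial, as a number at a jet, or as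
a differential function. -/
theorem map_noetherMatrix {R S : Type} [CommRing R] [CommRing S] (f : R →+* S) (a b c d e : R) :
    f.mapMatrix (noetherMatrix a b c d e) = noetherMatrix (f a) (f b) (f c) (f d) (f e) := by
  ext i j
  have h3 : f 3 = 3 := map_ofNat f 3
  have h4 : f 4 = 4 := map_ofNat f 4
  fin_cases i <;> fin_cases j <;> simp [noetherMatrix, h3, h4]

theorem dense_regularJets : Dense (regularJets : Set JetSpace) := by
  let X : Coord → MvPolynomial Coord ℝ := MvPolynomial.X
  let P : MvPolynomial Coord ℝ := (noetherMatrix (X (.jet 0 0)) (X (.jet 2 0)) (X (.jet 0 1))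
    (X (.jet 1 1)) (X (.jet 2 1))).det
  have hP : ∀ y : JetSpace, MvPolynomial.eval y P = (noetherMatrix (y (.jet 0 0)) (y (.jet 2 0))
      (y (.jet 0 1)) (y (.jet 1 1)) (y (.jet 2 1))).det := by
    intro y
    rw [RingHom.map_det, map_noetherMatrix]
    simp [X]
  have hset : (regularJets : Set JetSpace) = {y | MvPolynomial.eval y P ≠ 0} := by
    ext y
    rw [Set.mem_ofPred_eq, hP]
    rfl
  rw [hset]
  -- At the jet whose only nonzero coordinate is v_x = 1, the matrix is a permutation matrix with
  -- determinant -1.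
  refine dense_eval_ne_zero P (z := fun c => if c = .jet 1 1 then 1 else 0) ?_
  rw [hP]
  simp [noetherMatrix, Matrix.det_fin_three]

theorem isUnit_A₀mat (hW : W ≤ regularJets) :
    IsUnit (A₀mat : Matrix (Fin 3) (Fin 3) (DiffFun W)) := by
  rw [Matrix.isUnit_iff_isUnit_det]
  refine DiffFun.isUnit_of_ne_zero _ fun y => ?_
  rw [← evalAt_apply]
  change (evalAt y : DiffFun W →+* ℝ) _ ≠ 0
  rw [RingHom.map_det, A₀mat, map_noetherMatrix]
  exact hW y.2

/-! ### Transport of the brackets to the symmetries -/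

theorem A₀inv_A₀ (hA : IsUnit (A₀mat : Matrix (Fin 3) (Fin 3) (DiffFun W))) (p : Sec W) :
    mulMat A₀inv (A₀.toLin p) = p := by
  rw [A₀_toLin]
  change Matrix.mulVec A₀inv (Matrix.mulVec A₀mat p) = p
  rw [Matrix.mulVec_mulVec, A₀inv, Matrix.nonsing_inv_mul _ ((Matrix.isUnit_iff_isUnit_det _).1 hA),
    Matrix.one_mulVec]

theorem A₀_A₀inv (hA : IsUnit (A₀mat : Matrix (Fin 3) (Fin 3) (DiffFun W))) (φ : Sec W) :
    A₀.toLin (mulMat A₀inv φ) = φ := by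
  rw [A₀_toLin]
  change Matrix.mulVec A₀mat (Matrix.mulVec A₀inv φ) = φ
  rw [Matrix.mulVec_mulVec, A₀inv, Matrix.mul_nonsing_inv _ ((Matrix.isUnit_iff_isUnit_det _).1 hA),
    Matrix.one_mulVec]

theorem A₀inv_mem (hA : IsUnit (A₀mat : Matrix (Fin 3) (Fin 3) (DiffFun W))) {φ : Sec W}
    (hφ : φ ∈ symmetries W) : mulMat A₀inv φ ∈ cosymmetries W :=
  mem_cosymmetries_of_A₀_mem hA (by rwa [A₀_A₀inv hA])

/-- Every symmetry is the image under `A₀` of a cosymmetry. -/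
theorem exists_A₀_eq (hA : IsUnit (A₀mat : Matrix (Fin 3) (Fin 3) (DiffFun W))) {φ : Sec W}
    (hφ : φ ∈ symmetries W) : ∃ p ∈ cosymmetries W, A₀.toLin p = φ :=
  ⟨_, A₀inv_mem hA hφ, A₀_A₀inv hA φ⟩

theorem recOp_eq (i : Fin 2) (φ : Sec W) :
    recOp i φ = noether i.succ (mulMat A₀inv φ) := by
  fin_cases i <;> rfl

theorem hamIb_eq (i : Fin 2) (p q : Sec W) : hamIb i p q = noetherIb i.succ p q := by
  fin_cases i <;> rfl

theorem recOp_A₀ (hA : IsUnit (A₀mat : Matrix (Fin 3) (Fin 3) (DiffFun W))) (i : Fin 2)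
    (p : Sec W) : recOp i (A₀.toLin p) = noether i.succ p := by
  rw [recOp_eq, A₀inv_A₀ hA]

theorem evolSec_mulMat (φ : Sec W) (M : Matrix (Fin 3) (Fin 3) (DiffFun W)) (q : Sec W) :
    evolSec φ (mulMat M q) = mulMat (M.map (evol φ)) q + mulMat M (evolSec φ q) := by
  ext1 i
  simp only [evolSec, mulMat_apply, Pi.add_apply, map_add, derivation_mul, Matrix.map_apply]
  ring

/-- Obtained by applying E_φ to q = ω(A₀ q) and then A₀: the term with the derivative of ω removes
the derivative of the coefficients of A₀. -/
theorem evolSec_A₀_add (hA : IsUnit (A₀mat : Matrix (Fin 3) (Fin 3) (DiffFun W)))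
    (φ q : Sec W) : evolSec φ (A₀.toLin q) +
      A₀.toLin (mulMat (A₀inv.map (evol φ)) (A₀.toLin q)) = A₀.toLin (evolSec φ q) := by
  have h := evolSec_mulMat φ A₀inv (A₀.toLin q)
  rw [A₀inv_A₀ hA] at h
  rw [h, map_add, A₀_A₀inv hA, add_comm]

/-- The terms with derivatives of ω are built into the bracket of R_i precisely so that A₀
conjugates it to the bracket belonging to A_i. -/
theorem recBracket_A₀ (hA : IsUnit (A₀mat : Matrix (Fin 3) (Fin 3) (DiffFun W))) (i : Fin 2)
    (p q : Sec W) :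
    recBracket i (A₀.toLin p) (A₀.toLin q) = A₀.toLin (domBracket i.succ p q) := by
  rw [recBracket, recIb, recOp_A₀ hA, recOp_A₀ hA, A₀inv_A₀ hA, A₀inv_A₀ hA, ← A₀_toLin, hamIb_eq,
    domBracket, map_add, map_sub, map_add, map_sub, ← evolSec_A₀_add hA, ← evolSec_A₀_add hA]
  abel

theorem stdBracket_A₀ (p q : Sec W) :
    stdBracket (A₀.toLin p) (A₀.toLin q) = A₀.toLin (domBracket 0 p q) := by
  have h := stdBracket_noetherComb (Pi.single 0 1) p q
  rw [noetherComb_single, domBracketComb_apply, Finset.sum_eq_single 0] at h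
  · rwa [Pi.single_eq_same, one_smul] at h
  · intro j _ hj
    rw [Pi.single_eq_of_ne hj, zero_smul]
  · simp

/-- The deformed brackets in terms of the brackets on the cosymmetries. -/
theorem deformedBracket_A₀ (hA : IsUnit (A₀mat : Matrix (Fin 3) (Fin 3) (DiffFun W))) (a : ℝ)
    (c : Fin 2 → ℝ) (p q : Sec W) : deformedBracket a c (A₀.toLin p) (A₀.toLin q) =
      A₀.toLin (domBracketComb (Fin.cons a c : Fin 3 → ℝ) p q) := by
  rw [deformedBracket, stdBracket_A₀, domBracketComb_apply, Fin.sum_univ_succ (n := 2),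
    map_add, map_smul, map_sum]
  simp only [recBracket_A₀ hA, Fin.cons_zero, Fin.cons_succ, map_smul]

theorem add_sum_recOp (hA : IsUnit (A₀mat : Matrix (Fin 3) (Fin 3) (DiffFun W))) (a : ℝ)
    (c : Fin 2 → ℝ) (p : Sec W) : a • A₀.toLin p + ∑ i, c i • recOp i (A₀.toLin p) =
      noetherComb (Fin.cons a c : Fin 3 → ℝ) p := by
  rw [noetherComb_apply, Fin.sum_univ_succ (n := 2)]
  simp only [recOp_A₀ hA, Fin.cons_zero, Fin.cons_succ]
  rfl

theorem stdBracket_deformed (hA : IsUnit (A₀mat : Matrix (Fin 3) (Fin 3) (DiffFun W))) (a : ℝ)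
    (c : Fin 2 → ℝ) (φ ψ : Sec W) :
    stdBracket (a • φ + ∑ i, c i • recOp i φ) (a • ψ + ∑ i, c i • recOp i ψ) =
      a • deformedBracket a c φ ψ + ∑ i, c i • recOp i (deformedBracket a c φ ψ) := by
  rw [← A₀_A₀inv hA φ, ← A₀_A₀inv hA ψ, deformedBracket_A₀ hA, add_sum_recOp hA, add_sum_recOp hA,
    add_sum_recOp hA, stdBracket_noetherComb]

theorem recOp_mem (hA : IsUnit (A₀mat : Matrix (Fin 3) (Fin 3) (DiffFun W))) (i : Fin 2)
    {φ : Sec W} (hφ : φ ∈ symmetries W) : recOp i φ ∈ symmetries W := by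
  rw [recOp_eq]
  exact noether_mem_symmetries _ (A₀inv_mem hA hφ)

theorem hasInvolutiveImage_recOp (hA : IsUnit (A₀mat : Matrix (Fin 3) (Fin 3) (DiffFun W)))
    (c : Fin 2 → ℝ) :
    HasInvolutiveImage (symmetries W) (∑ i, c i • (recOp i : Sec W →ₗ[ℝ] Sec W)) := by
  intro φ hφ ψ hψ
  obtain ⟨p, hp, rfl⟩ := exists_A₀_eq hA hφ
  obtain ⟨q, hq, rfl⟩ := exists_A₀_eq hA hψ
  refine ⟨_, A₀_mem_symmetries (domBracketComb_mem (Fin.cons 0 c : Fin 3 → ℝ) hp hq), ?_⟩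
  have key : ∀ p : Sec W, (∑ i, c i • (recOp i : Sec W →ₗ[ℝ] Sec W)) (A₀.toLin p) =
      noetherComb (Fin.cons 0 c : Fin 3 → ℝ) p := by
    intro p
    rw [← add_sum_recOp hA, zero_smul, zero_add]
    simp only [LinearMap.sum_apply, LinearMap.smul_apply]
  rw [key, key, key, stdBracket_noetherComb]

theorem linearCompatible_recOp (hA : IsUnit (A₀mat : Matrix (Fin 3) (Fin 3) (DiffFun W))) :
    LinearCompatible (symmetries W) (recOp : Fin 2 → Sec W →ₗ[ℝ] Sec W) := by
  refine ⟨fun i => ?_, hasInvolutiveImage_recOp hA⟩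
  have h := hasInvolutiveImage_recOp hA (Pi.single i 1)
  rwa [Finset.sum_eq_single i, Pi.single_eq_same, one_smul] at h
  · intro j _ hj
    rw [Pi.single_eq_of_ne hj, zero_smul]
  · simp

theorem domBracketComb_self (c : Fin 3 → ℝ) (p : Sec W) : domBracketComb c p p = 0 := by
  rw [domBracketComb_apply]
  refine Finset.sum_eq_zero fun i _ => ?_
  have h : domBracket i p p = 0 := by
    have h2 := domBracket_swap i p p
    rw [eq_neg_iff_add_eq_zero, ← two_smul ℝ] at h2
    exact (smul_eq_zero.1 h2).resolve_left two_ne_zero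
  rw [h, smul_zero]

/-- The deformed brackets are Lie brackets on the symmetries. -/
theorem isLieBracketOn_deformedBracket
    (hA : IsUnit (A₀mat : Matrix (Fin 3) (Fin 3) (DiffFun W))) (a : ℝ) (c : Fin 2 → ℝ) :
    IsLieBracketOn (symmetries W) (deformedBracket a c) := by
  have key : ∀ φ ψ : Sec W, deformedBracket a c φ ψ = A₀.toLin (domBracketComb
      (Fin.cons a c : Fin 3 → ℝ) (mulMat A₀inv φ) (mulMat A₀inv ψ)) := by
    intro φ ψ
    rw [← deformedBracket_A₀ hA, A₀_A₀inv hA, A₀_A₀inv hA]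
  refine ⟨?_, ?_, ?_, ?_, ?_, ?_, ?_⟩
  · intro φ hφ ψ hψ
    rw [key]
    exact A₀_mem_symmetries (domBracketComb_mem _ (A₀inv_mem hA hφ) (A₀inv_mem hA hψ))
  · intro φ _ ψ _ χ _
    simp only [key, map_add, LinearMap.add_apply]
  · intro φ _ ψ _ χ _
    simp only [key, map_add]
  · intro r φ _ ψ _
    simp only [key, map_smul, LinearMap.smul_apply]
  · intro r φ _ ψ _
    simp only [key, map_smul]
  · intro φ _
    rw [key, domBracketComb_self, map_zero]
  · intro φ _ ψ _ χ _
    simp only [key, A₀inv_A₀ hA, ← map_add]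
    rw [domBracketComb_jacobi, map_zero]

/-! ### Linear independence of the brackets -/

theorem A₀_injective (hA : IsUnit (A₀mat : Matrix (Fin 3) (Fin 3) (DiffFun W))) {p : Sec W}
    (hp : A₀.toLin p = 0) : p = 0 := by
  rw [← A₀inv_A₀ hA p, hp, map_zero]

/-- The cosymmetry of the dilation `x u_x + t u_t`. -/
def dilation : Sec W := ![coord .t, 0, coord .x]

theorem dilation_mem : (dilation : Sec W) ∈ cosymmetries W := by
  rw [mem_cosymmetries_iff]
  simp [dilation]

theorem evolSec_dilation (φ : Sec W) : evolSec φ dilation = 0 := by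
  ext1 b
  simp only [evolSec, dilation, Pi.zero_apply]
  fin_cases b <;> simp

/-- The cosymmetry of twice the conserved density `u v + u w ^ 2 / 2`. -/
def momentum : Sec W := ![2 * v + w ^ 2, 2 * u, 2 * u * w]

theorem momentum_mem : (momentum : Sec W) ∈ cosymmetries W := by
  rw [mem_cosymmetries_iff]
  simp only [momentum, Matrix.cons_val, Fin.isValue, derivation_mul, derivation_ofNat,
    derivation_sq, map_add, Dx_u, Dx_v, Dx_w, Dt_u, Dt_v, Dt_w]
  exact ⟨by ring, by ring, by ring⟩

theorem const_mem₀ : (![1, 0, 0] : Sec W) ∈ cosymmetries W := by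
  rw [mem_cosymmetries_iff]
  simp

theorem const_mem₂ : (![0, 0, 1] : Sec W) ∈ cosymmetries W := by
  rw [mem_cosymmetries_iff]
  simp

theorem evolSec_const₀ (φ : Sec W) : evolSec φ ![1, 0, 0] = 0 := by
  ext1 b
  simp only [evolSec, Pi.zero_apply]
  fin_cases b <;> simp

theorem evolSec_const₂ (φ : Sec W) : evolSec φ ![0, 0, 1] = 0 := by
  ext1 b
  simp only [evolSec, Pi.zero_apply]
  fin_cases b <;> simp

/-- Neither argument involves u, v, w, so only the bi-differential part contributes. The weights
here and in `domBracket_dilation_const₂` differ for A₂ and agree for A₀, which separates these two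
operators. -/
theorem domBracket_dilation_const₀ (i : Fin 3) :
    domBracket i dilation ![1, 0, 0] = (![1, 0, 2] : Fin 3 → ℝ) i • (![1, 0, 0] : Sec W) := by
  rw [domBracket, evolSec_dilation, evolSec_const₀]
  ext1 b
  fin_cases i <;> fin_cases b <;>
    simp [noetherIb, ib₀, ib₁, ib₂, dilation, two_smul, one_add_one_eq_two]

theorem domBracket_dilation_const₂ (i : Fin 3) :
    domBracket i dilation ![0, 0, 1] = (![1, 0, 1] : Fin 3 → ℝ) i • (![0, 0, 1] : Sec W) := by
  rw [domBracket, evolSec_dilation, evolSec_const₂]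
  ext1 b
  fin_cases i <;> fin_cases b <;> simp [noetherIb, ib₀, ib₁, ib₂, dilation]

/-- The A₁-brackets of the dilation with the two constant cosymmetries vanish, so a cosymmetry
depending on the jets is needed. Here A₁(t,0,x) = (0,1,0) is the shift of v, under which 2v + w²
changes by 2. -/
theorem domBracket_dilation_momentum :
    domBracket 1 dilation momentum = (![2, 0, 0] : Sec W) := by
  rw [domBracket, evolSec_dilation]
  ext1 b
  fin_cases b <;> simp [noether, noetherIb, A₁_apply, ib₁, dilation, momentum, evolSec, u, v, w,
    DxPow_zero, derivation_ofNat]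

theorem linearIndependent_brackets
    (hA : IsUnit (A₀mat : Matrix (Fin 3) (Fin 3) (DiffFun W))) (hW : (W : Set JetSpace).Nonempty) :
    LinearIndependent ℝ ![onSym (stdBracket : Sec W → Sec W → Sec W),
      onSym (recBracket 0), onSym (recBracket 1)] := by
  obtain ⟨y, hy⟩ := hW
  rw [Fintype.linearIndependent_iff]
  intro g hg
  have key : ∀ p ∈ cosymmetries W, ∀ q ∈ cosymmetries W, ∑ i, g i • domBracket i p q = 0 := by
    intro p hp q hq
    apply A₀_injective hA
    have h := congrFun (congrFun hg ⟨_, A₀_mem_symmetries hp⟩) ⟨_, A₀_mem_symmetries hq⟩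
    have h0 : onSym (stdBracket : Sec W → Sec W → Sec W) ⟨_, A₀_mem_symmetries hp⟩
        ⟨_, A₀_mem_symmetries hq⟩ = A₀.toLin (domBracket 0 p q) := stdBracket_A₀ p q
    have h1 : ∀ i : Fin 2, onSym (recBracket i : Sec W → Sec W → Sec W)
        ⟨_, A₀_mem_symmetries hp⟩ ⟨_, A₀_mem_symmetries hq⟩ =
        A₀.toLin (domBracket i.succ p q) := fun i => recBracket_A₀ hA i p q
    simp only [Fin.sum_univ_three, Matrix.cons_val, Fin.isValue, Pi.add_apply, Pi.smul_apply,
      h0, h1, Pi.zero_apply] at h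
    simpa only [Fin.sum_univ_three, map_add, map_smul, Fin.succ_zero_eq_one,
      Fin.succ_one_eq_two] using h
  -- The first two equations read g₀ + 2g₂ = 0 and g₀ + g₂ = 0; once g₀ and g₂ vanish, the third
  -- reads 2g₁ = 0.
  have k0 := congrArg (evalAt ⟨y, hy⟩) (congrFun (key _ dilation_mem _ const_mem₀) 0)
  have k2 := congrArg (evalAt ⟨y, hy⟩) (congrFun (key _ dilation_mem _ const_mem₂) 2)
  have k1 := congrArg (evalAt ⟨y, hy⟩) (congrFun (key _ dilation_mem _ momentum_mem) 0)
  simp only [domBracket_dilation_const₀, domBracket_dilation_const₂, Fin.sum_univ_three,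
    Pi.add_apply, Pi.smul_apply, Matrix.cons_val, Fin.isValue, map_add, map_smul, map_one,
    Pi.zero_apply, map_zero, smul_eq_mul] at k0 k2
  have g2 : g 2 = 0 := by linarith
  have g0 : g 0 = 0 := by linarith
  have g1 : g 1 = 0 := by
    simp only [Fin.sum_univ_three, g0, g2, zero_smul, zero_add, add_zero,
      domBracket_dilation_momentum, Pi.smul_apply, Matrix.cons_val, Fin.isValue, map_smul,
      Pi.zero_apply, map_zero, map_ofNat, smul_eq_mul] at k1
    linarith
  intro i
  fin_cases i
  exacts [g0, g1, g2]

theorem finrank_span_recBracket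
    (hA : IsUnit (A₀mat : Matrix (Fin 3) (Fin 3) (DiffFun W))) (hW : (W : Set JetSpace).Nonempty) :
    Module.finrank ℝ (Submodule.span ℝ (Set.range fun i : Fin 2 =>
      onSym (recBracket i : Sec W → Sec W → Sec W))) = 2 := by
  have h := (linearIndependent_brackets hA hW).comp Fin.succ (Fin.succ_injective 2)
  have h2 : LinearIndependent ℝ fun i : Fin 2 =>
      onSym (recBracket i : Sec W → Sec W → Sec W) := by
    convert h using 1
    funext i
    fin_cases i <;> rfl
  rw [finrank_span_eq_card h2, Fintype.card_fin]

/-! ### Hydrodynamic operators with respect to the independent variable -/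

theorem pd_eq_vectorField (c : Coord) (f : DiffFun W) :
    pd c f = vectorField (Pi.single c 1) f := by
  rw [vectorField_apply, finsum_eq_single _ c]
  · rw [Pi.single_eq_same, one_mul]
  · intro d hd
    rw [Pi.single_eq_of_ne hd, zero_mul]

theorem derivation_single (D : Derivation ℝ (DiffFun W) (DiffFun W)) (c d : Coord) :
    D ((Pi.single c 1 : Coord → DiffFun W) d) = 0 := by
  by_cases hcd : d = c
  · rw [hcd, Pi.single_eq_same, Derivation.map_one_eq_zero]
  · rw [Pi.single_eq_of_ne hcd, map_zero]

theorem pd_vectorField (c : Coord) (Y : Coord → DiffFun W) (f : DiffFun W) :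
    pd c (vectorField Y f) = vectorField Y (pd c f) + vectorField (fun d => pd c (Y d)) f := by
  rw [← sub_eq_iff_eq_add', pd_eq_vectorField, pd_eq_vectorField c f, vectorField_comm]
  simp only [derivation_single, sub_zero, pd_eq_vectorField]

/-- The only coefficient of D_x that depends on u^a_{k+1} is that of ∂/∂u^a_k, so [∂/∂u^a_{k+1},
D_x] = ∂/∂u^a_k. -/
theorem pd_jet_succ_Dx (a : Fin 3) (k : ℕ) (f : DiffFun W) :
    pd (.jet a (k + 1)) (Dx f) = Dx (pd (.jet a (k + 1)) f) + pd (.jet a k) f := by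
  rw [Dx, pd_vectorField]
  refine congrArg₂ _ rfl ?_
  rw [pd_eq_vectorField (.jet a k)]
  refine congrFun (congrArg DFunLike.coe (congrArg vectorField (funext fun d => ?_))) f
  cases d with
  | x => rw [Derivation.map_one_eq_zero, Pi.single_eq_of_ne (by simp)]
  | t => rw [map_zero, Pi.single_eq_of_ne (by simp)]
  | jet b l =>
    simp only [pd_coord, Pi.single_apply, Coord.jet.injEq, Nat.add_right_cancel_iff,
      eq_comm (a := a), eq_comm (a := k)]

/-- Functions of `t`, `u`, `v` and `w`. -/
def hydro (W : Opens JetSpace) : Subalgebra ℝ (DiffFun W) where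
  carrier := {f | (∀ a k, pd (.jet a (k + 1)) f = 0) ∧ pd .x f = 0}
  mul_mem' := fun {f g} hf hg => by
    refine ⟨fun a k => ?_, ?_⟩
    · rw [derivation_mul, hf.1, hg.1, zero_mul, mul_zero, add_zero]
    · rw [derivation_mul, hf.2, hg.2, zero_mul, mul_zero, add_zero]
  add_mem' := fun {f g} hf hg => by
    refine ⟨fun a k => ?_, ?_⟩
    · rw [map_add, hf.1, hg.1, add_zero]
    · rw [map_add, hf.2, hg.2, add_zero]
  algebraMap_mem' := fun r => ⟨fun _ _ => Derivation.map_algebraMap _ _,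
    Derivation.map_algebraMap _ _⟩

theorem pd_jet_hydro_mul (g : hydro W) (a : Fin 3) (k : ℕ) (f : DiffFun W) :
    pd (.jet a (k + 1)) ((g : DiffFun W) * f) = g * pd (.jet a (k + 1)) f := by
  rw [derivation_mul, g.2.1, zero_mul, zero_add]

theorem pd_x_hydro_mul (g : hydro W) (f : DiffFun W) : pd .x ((g : DiffFun W) * f) = g * pd .x f := by
  rw [derivation_mul, g.2.2, zero_mul, zero_add]

theorem coord_t_mem : (coord .t : DiffFun W) ∈ hydro W :=
  ⟨fun _ _ => pd_coord_of_ne (by simp), pd_coord_of_ne (by simp)⟩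

theorem coord_jet_zero_mem (a : Fin 3) : (coord (.jet a 0) : DiffFun W) ∈ hydro W :=
  ⟨fun _ _ => pd_coord_of_ne (by simp), pd_coord_of_ne (by simp)⟩

theorem Dx_eq_of_order_zero {f : DiffFun W} (hf : ∀ a k, pd (.jet a (k + 1)) f = 0) :
    Dx f = pd .x f + ∑ a, coord (.jet a 1) * pd (.jet a 0) f := by
  rw [Dx, vectorField_eq_sum (s := {.x, .t, .jet 0 0, .jet 1 0, .jet 2 0})]
  · simp [Fin.sum_univ_three, add_assoc]
  · intro c hc
    cases c with
    | x => simp at hc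
    | t => simp at hc
    | jet a k =>
      cases k with
      | zero => fin_cases a <;> simp at hc
      | succ k => exact hf a k

/-- A first-order hydrodynamic operator that does not depend on `x` and has a nondegenerate leading
coefficient does not take the value `x u_x + Q u_x`. -/
theorem not_hydrodynamic_dilation (G : Matrix (Fin 3) (Fin 3) (hydro W))
    (L : Fin 3 → Matrix (Fin 3) (Fin 3) (hydro W)) (Q : Fin 3 → Fin 3 → hydro W)
    (hG : ∀ f : DiffFun W, (G.det : DiffFun W) * f = 0 → f = 0) (p : Sec W)
    (hp : ∀ i, ∑ j, (G i j : DiffFun W) * Dx (p j) +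
        ∑ a, coord (.jet a 1) * ∑ j, (L a i j : DiffFun W) * p j =
      ∑ a, coord (.jet a 1) * ((if a = i then coord .x else 0) + (Q a i : DiffFun W))) :
    (1 : DiffFun W) = 0 := by
  -- Multiplication by the adjugate reduces injectivity of G to the fact that its determinant is not
  -- a zero divisor.
  have hinj : ∀ f : Sec W, (∀ i, ∑ j, (G i j : DiffFun W) * f j = 0) → f = 0 := by
    intro f hf
    set G' : Matrix (Fin 3) (Fin 3) (DiffFun W) := (hydro W).val.mapMatrix G with hG'
    have h1 : G'.mulVec f = 0 := funext hf
    have h2 : G'.det • f = 0 := by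
      rw [← Matrix.one_mulVec f, ← Matrix.smul_mulVec, ← Matrix.adjugate_mul,
        ← Matrix.mulVec_mulVec, h1, Matrix.mulVec_zero]
    funext j
    refine hG _ ?_
    have h3 : (G.det : DiffFun W) = G'.det := AlgHom.map_det (hydro W).val G
    rw [h3]
    exact congrFun h2 j
  -- Descent on the order of p. If p has order at most N + 1 with N ≥ 0, then u^a_{N+2} enters the
  -- equation only through D_x p, with coefficient G ∂p/∂u^a_{N+1}; injectivity of G lowers the
  -- order.
  have hstep : ∀ N, (∀ k, N + 1 ≤ k → ∀ a j, pd (.jet a k) (p j) = 0) →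
      ∀ a j k, pd (.jet a (k + 1)) (p j) = 0 := by
    intro N
    induction N with
    | zero => exact fun h a j k => h (k + 1) (by omega) a j
    | succ N ih =>
      intro h
      refine ih fun k hk a j => ?_
      rcases Nat.eq_or_lt_of_le hk with rfl | hk
      · refine congrFun (hinj (fun j => pd (.jet a (N + 1)) (p j)) fun i => ?_) j
        have h1 := congrArg (pd (.jet a (N + 1 + 1))) (hp i)
        have h2 : ∀ b, pd (.jet a (N + 1 + 1)) (coord (.jet b 1) : DiffFun W) = 0 := fun b =>
          pd_coord_of_ne (by simp)
        have h3 : pd (.jet a (N + 1 + 1)) (coord .x : DiffFun W) = 0 := pd_coord_of_ne (by simp)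
        have h4 : ∀ b, pd (.jet a (N + 1 + 1)) (if b = i then (coord .x : DiffFun W) else 0) = 0 :=
          fun b => by split_ifs <;> simp [h3]
        simpa only [map_add, map_sum, derivation_mul _ (coord _), h2, pd_jet_hydro_mul, h4,
          pd_jet_succ_Dx, h _ le_rfl, (Q _ _).2.1, map_zero, mul_zero, zero_mul, zero_add, add_zero,
          Finset.sum_const_zero] using h1
      · exact h k hk a j
  have hord : ∀ a j k, pd (.jet a (k + 1)) (p j) = 0 := by
    have hfin : (⋃ j, {c | pd c (p j) ≠ 0}).Finite := Set.finite_iUnion fun j => finite_pd (p j)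
    have hfin2 : (⋃ a : Fin 3, (fun k => Coord.jet a k) ⁻¹' ⋃ j, {c | pd c (p j) ≠ 0}).Finite :=
      Set.finite_iUnion fun a => hfin.preimage (fun k _ l _ h => by simpa using h)
    obtain ⟨N, hN⟩ := hfin2.bddAbove
    refine hstep N fun k hk a j => ?_
    by_contra hne
    have : k ≤ N := hN (Set.mem_iUnion.2 ⟨a, Set.mem_iUnion.2 ⟨j, hne⟩⟩)
    omega
  -- With p of order zero the equation is affine in the first derivatives; this is the coefficient
  -- of u^a_1.
  have hlin : ∀ a i, ∑ j, (G i j : DiffFun W) * pd (.jet a 0) (p j) +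
      ∑ j, (L a i j : DiffFun W) * p j = (if a = i then coord .x else 0) + (Q a i : DiffFun W) := by
    intro a i
    have h1 := congrArg (pd (.jet a (0 + 1))) (hp i)
    have h2 : ∀ b, pd (.jet a (0 + 1)) (coord (.jet b 1) : DiffFun W) = if b = a then 1 else 0 :=
      fun b => by rw [pd_jet_coord]; simp [eq_comm]
    have h3 : pd (.jet a (0 + 1)) (coord .x : DiffFun W) = 0 := pd_coord_of_ne (by simp)
    have h4 : ∀ b, pd (.jet a (0 + 1)) (if b = i then (coord .x : DiffFun W) else 0) = 0 :=
      fun b => by split_ifs <;> simp [h3]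
    simpa only [map_add, map_sum, derivation_mul _ (coord _), h2, pd_jet_hydro_mul, h4,
      pd_jet_succ_Dx, hord, (Q _ _).2.1, map_zero, mul_zero, zero_add, add_zero, ite_mul, one_mul,
      zero_mul, Finset.sum_const_zero, Finset.sum_ite_eq', Finset.mem_univ, if_true] using h1
  -- The remaining terms, free of first derivatives, say that G ∂p/∂x = 0.
  have hx : (fun j => pd .x (p j)) = 0 := by
    refine hinj _ fun i => ?_
    have h1 := hp i
    have h2 : ∑ a, coord (.jet a 1) * (∑ j, (G i j : DiffFun W) * pd (.jet a 0) (p j) +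
        ∑ j, (L a i j : DiffFun W) * p j) = ∑ a, coord (.jet a 1) *
          ((if a = i then coord .x else 0) + (Q a i : DiffFun W)) :=
      Finset.sum_congr rfl fun a _ => by rw [hlin]
    simp only [Dx_eq_of_order_zero fun a k => hord a _ k] at h1
    rw [← h2] at h1
    simp only [Fin.sum_univ_three] at h1 ⊢
    linear_combination h1
  -- Nothing on the left of `hlin` depends on x any more, while the right side is x plus a function
  -- free of x; differentiating by x gives 0 = 1.
  have h1 := congrArg (pd .x) (hlin 0 0)
  have h2 : ∀ j, pd .x (pd (.jet 0 0) (p j)) = 0 := fun j => by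
    rw [pd_comm, congrFun hx j, Pi.zero_apply, map_zero]
  rw [if_pos rfl, map_add, map_add, map_sum, map_sum, (Q 0 0).2.2, pd_coord_self] at h1
  simp only [pd_x_hydro_mul, h2, fun j => congrFun hx j, Pi.zero_apply, mul_zero,
    Finset.sum_const_zero, add_zero] at h1
  exact h1.symm

/-! ### The leading coefficients of linear combinations -/

/-- The leading coefficient of `c A₁ + d A₂`, over any commutative ring. -/
def leadMatrix {R : Type} [CommRing R] (c d u v w : R) : Matrix (Fin 3) (Fin 3) R :=
  !![c + d * (2 * w ^ 2 + 4 * v), -11 * d * u * w, 3 * d * u;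
     -11 * d * u * w, -4 * c * w - d * (3 * u ^ 2 + 16 * v * w + 6 * w ^ 3), c + 4 * d * v;
     3 * d * u, c + 4 * d * v, 2 * d * w]

theorem map_leadMatrix {R S : Type} [CommRing R] [CommRing S] (f : R →+* S) (c d a b e : R) :
    f.mapMatrix (leadMatrix c d a b e) = leadMatrix (f c) (f d) (f a) (f b) (f e) := by
  have hn : ∀ n : ℕ, ∀ [n.AtLeastTwo], f (OfNat.ofNat n) = OfNat.ofNat n := fun n _ => map_ofNat f n
  ext i j
  fin_cases i <;> fin_cases j <;> simp [leadMatrix, hn]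

/-- If f were nonzero somewhere, continuity would make it nonzero on an open set, which meets the
dense set where P does not vanish. -/
theorem eq_zero_of_eval_mul (P : MvPolynomial Coord ℝ) {z : JetSpace}
    (hz : MvPolynomial.eval z P ≠ 0) {f : DiffFun W}
    (hf : ∀ y : W, MvPolynomial.eval (y : JetSpace) P * evalAt y f = 0) : f = 0 := by
  by_contra hne
  obtain ⟨y, hy⟩ : ∃ y, (f : W → ℝ) y ≠ 0 := by
    by_contra! h
    exact hne (Subtype.ext (funext h))
  have hopen : IsOpen (Subtype.val '' {y : W | (f : W → ℝ) y ≠ 0}) :=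
    W.isOpen.isOpenMap_subtype_val _ (isOpen_ne_fun (DiffFun.continuous f) continuous_const)
  obtain ⟨_, hz1, y', hy', rfl⟩ :=
    (dense_eval_ne_zero P hz).inter_open_nonempty _ hopen ⟨_, y, hy, rfl⟩ |>.imp fun _ h => h.symm
  exact hy' ((mul_eq_zero.1 (hf y')).resolve_left hz1)

theorem leadMatrix_det_mul {c d : ℝ} (hcd : c ≠ 0 ∨ d ≠ 0) {f : DiffFun W}
    (hf : (leadMatrix (algebraMap ℝ (DiffFun W) c) (algebraMap ℝ (DiffFun W) d) u v w).det * f = 0) :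
    f = 0 := by
  let X : Coord → MvPolynomial Coord ℝ := MvPolynomial.X
  let P : MvPolynomial Coord ℝ := (leadMatrix (MvPolynomial.C c) (MvPolynomial.C d)
    (X (.jet 0 0)) (X (.jet 1 0)) (X (.jet 2 0))).det
  have hP : ∀ y : JetSpace, MvPolynomial.eval y P =
      (leadMatrix c d (y (.jet 0 0)) (y (.jet 1 0)) (y (.jet 2 0))).det := by
    intro y
    rw [RingHom.map_det, map_leadMatrix]
    simp [X]
  -- At u = w = 0, v = s the determinant is -(c + 4ds)³, so any s with c + 4ds nonzero is a witness;
  -- for d ≠ 0 the choice makes this value 1.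
  obtain ⟨s, hs⟩ : ∃ s : ℝ, c + 4 * d * s ≠ 0 := by
    by_cases hd : d = 0
    · exact ⟨0, by simpa [hd] using hcd⟩
    · refine ⟨(1 - c) / (4 * d), ?_⟩
      field_simp
      simp
  refine eq_zero_of_eval_mul P (z := fun k => if k = .jet 1 0 then s else 0) ?_ fun y => ?_
  · rw [hP]
    have : (leadMatrix c d 0 s 0).det = -(c + 4 * d * s) ^ 3 := by
      simp [leadMatrix, Matrix.det_fin_three]
      ring
    simpa [this] using hs
  · have h := congrArg (evalAt y) hf
    rw [map_mul, map_zero] at h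
    rw [hP, ← h]
    congr 1

/-- The dilation is not in the image of `a A₀ + c₀ A₁ + c₁ A₂` unless `c = 0`. -/
theorem noetherComb_ne_dilation (hW : (W : Set JetSpace).Nonempty) (a : ℝ) {c : Fin 2 → ℝ}
    (hc : c ≠ 0) (p : Sec W) :
    noetherComb (Fin.cons a c : Fin 3 → ℝ) p ≠ A₀.toLin dilation := by
  intro hp
  obtain ⟨y, hy⟩ := hW
  let U : hydro W := ⟨u, coord_jet_zero_mem 0⟩
  let V : hydro W := ⟨v, coord_jet_zero_mem 1⟩
  let Z : hydro W := ⟨w, coord_jet_zero_mem 2⟩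
  let T : hydro W := ⟨coord .t, coord_t_mem⟩
  let a' : hydro W := algebraMap ℝ _ a
  let c' : hydro W := algebraMap ℝ _ (c 0)
  let d' : hydro W := algebraMap ℝ _ (c 1)
  have hcd : c 0 ≠ 0 ∨ c 1 ≠ 0 := by
    by_contra! h
    exact hc (funext fun i => by fin_cases i; exacts [h.1, h.2])
  have hone : (1 : DiffFun W) = 0 := by
    -- The three matrices collect the coefficients of u_x, v_x and w_x in the order-zero part of the
    -- combination. The last argument collects, by the same derivatives, the part of A₀(t,0,x)
    -- proportional to t; the part with x is the diagonal term.
    refine not_hydrodynamic_dilation (leadMatrix c' d' U V Z)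
      ![!![0, -3 * a' * Z - 5 * d' * Z, a' + d';
          -3 * a' * Z - 6 * d' * Z, -a' * U - 3 * d' * U, 0;
          a' + 2 * d', 0, 0],
        !![a' + 2 * d', 0, 0;
          0, -4 * a' * Z - 8 * d' * Z, a' + d';
          0, a' + 3 * d', 0],
        !![a' * Z + 2 * d' * Z, -a' * U - 9 * d' * U, 0;
          -a' * U - 2 * d' * U, -3 * a' * Z ^ 2 - 2 * c' - 8 * d' * V - 9 * d' * Z ^ 2, 0;
          0, 0, a' + d']]
      ![![0, -3 * T * Z, T], ![T, 0, 0], ![T * Z, -T * U, 0]] ?_ p ?_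
    · intro f hf
      refine leadMatrix_det_mul hcd ?_
      rw [← hf]
      congr 1
    · intro i
      have h := congrFun hp i
      rw [noetherComb_apply, Fin.sum_univ_three] at h
      change (a • A₀.toLin p + c 0 • A₁.toLin p + c 1 • A₂.toLin p) i = _ at h
      have e : ∀ r : ℝ, ((algebraMap ℝ (hydro W) r : hydro W) : DiffFun W) =
          algebraMap ℝ (DiffFun W) r := fun _ => rfl
      simp only [Pi.add_apply, Pi.smul_apply, A₀_apply, A₁_apply, A₂_apply, dilation] at h
      simp only [Algebra.smul_def] at h
      have hU : (coord (.jet 0 1) : DiffFun W) = ux := rfl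
      have hV : (coord (.jet 1 1) : DiffFun W) = vx := rfl
      have hZ : (coord (.jet 2 1) : DiffFun W) = wx := rfl
      have e2 : ((2 : hydro W) : DiffFun W) = 2 := rfl
      have e3 : ((3 : hydro W) : DiffFun W) = 3 := rfl
      have e4 : ((4 : hydro W) : DiffFun W) = 4 := rfl
      have e5 : ((5 : hydro W) : DiffFun W) = 5 := rfl
      have e6 : ((6 : hydro W) : DiffFun W) = 6 := rfl
      have e8 : ((8 : hydro W) : DiffFun W) = 8 := rfl
      have e9 : ((9 : hydro W) : DiffFun W) = 9 := rfl
      have e11 : ((11 : hydro W) : DiffFun W) = 11 := rfl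
      have e16 : ((16 : hydro W) : DiffFun W) = 16 := rfl
      fin_cases i <;>
      · simp only [Fin.sum_univ_three, leadMatrix, Matrix.of_apply, Matrix.cons_val, Fin.isValue,
          Fin.zero_eta, Fin.mk_one, Fin.reduceFinMk, hU, hV, hZ, Subalgebra.coe_add,
          Subalgebra.coe_mul, Subalgebra.coe_neg, Subalgebra.coe_sub, Subalgebra.coe_pow,
          Subalgebra.coe_zero, e2, e3, e4, e5, e6, e8, e9, e11, e16, U, V, Z, T,
          a', c', d', e, Fin.reduceEq, if_true, if_false]
          at h ⊢
        linear_combination h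
  simpa using congrArg (evalAt ⟨y, hy⟩) hone

/-! ### Nontriviality of the deformations -/

/-- The ideal of the differential functions all of whose total `x`-derivatives vanish at `y`. -/
def flatIdeal (y : W) : Ideal (DiffFun W) where
  carrier := {f | ∀ m, evalAt y (DxPow m f) = 0}
  add_mem' := fun {f g} hf hg m => by rw [map_add, map_add, hf m, hg m, add_zero]
  zero_mem' := fun m => by rw [map_zero, map_zero]
  smul_mem' := fun g f hf m => by
    rw [smul_eq_mul]
    induction m generalizing f g with
    | zero =>
      rw [DxPow_zero, map_mul, ← DxPow_zero f, hf 0, mul_zero]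
    | succ m ih =>
      rw [DxPow_succ', derivation_mul, map_add, map_add, ih _ f hf,
        ih g (Dx f) fun k => by rw [← DxPow_succ', hf], add_zero]

theorem DxPow_add (m k : ℕ) (f : DiffFun W) : DxPow m (DxPow k f) = DxPow (m + k) f := by
  induction m with
  | zero => rw [DxPow_zero, zero_add]
  | succ m ih => rw [DxPow_succ, ih, Nat.succ_add, DxPow_succ]

theorem DxPow_mem_flatIdeal {y : W} {f : DiffFun W} (hf : f ∈ flatIdeal y) (k : ℕ) :
    DxPow k f ∈ flatIdeal y := fun m => by rw [DxPow_add, hf]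

theorem Dx_mem_flatIdeal {y : W} {f : DiffFun W} (hf : f ∈ flatIdeal y) : Dx f ∈ flatIdeal y :=
  DxPow_mem_flatIdeal hf 1

/-- The sections that are flat at `y`. -/
def flatSec (y : W) : Submodule ℝ (Sec W) where
  carrier := {φ | ∀ i, φ i ∈ flatIdeal y}
  add_mem' := fun hφ hψ i => add_mem (hφ i) (hψ i)
  zero_mem' := fun _ => zero_mem _
  smul_mem' := fun r φ hφ i => by
    rw [Pi.smul_apply, Algebra.smul_def]
    exact Ideal.mul_mem_left _ _ (hφ i)

theorem mulMat_mem_flatSec {y : W} (M : Matrix (Fin 3) (Fin 3) (DiffFun W)) {φ : Sec W}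
    (hφ : φ ∈ flatSec y) : mulMat M φ ∈ flatSec y := fun i => by
  rw [mulMat_apply]
  exact add_mem (add_mem (Ideal.mul_mem_left _ _ (hφ 0)) (Ideal.mul_mem_left _ _ (hφ 1)))
    (Ideal.mul_mem_left _ _ (hφ 2))

theorem mulMat_mem_flatSec_left {y : W} {M : Matrix (Fin 3) (Fin 3) (DiffFun W)}
    (hM : ∀ i j, M i j ∈ flatIdeal y) (φ : Sec W) : mulMat M φ ∈ flatSec y := fun i => by
  rw [mulMat_apply]
  exact add_mem (add_mem (Ideal.mul_mem_right _ _ (hM i 0)) (Ideal.mul_mem_right _ _ (hM i 1)))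
    (Ideal.mul_mem_right _ _ (hM i 2))

theorem toLin_apply (T : TDOp W) (φ : Sec W) :
    T.toLin φ = ∑ k ∈ T.support, mulMat (T k) fun i => DxPow k (φ i) := by
  rw [TDOp.toLin, LinearMap.sum_apply]
  rfl

theorem toLin_mem_flatSec {y : W} (T : TDOp W) {φ : Sec W} (hφ : φ ∈ flatSec y) :
    T.toLin φ ∈ flatSec y := by
  rw [toLin_apply]
  exact Submodule.sum_mem _ fun k _ =>
    mulMat_mem_flatSec _ fun i => DxPow_mem_flatIdeal (hφ i) k

theorem recOp_mem_flatSec {y : W} (i : Fin 2) {φ : Sec W} (hφ : φ ∈ flatSec y) :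
    recOp i φ ∈ flatSec y :=
  toLin_mem_flatSec (ham i) (mulMat_mem_flatSec _ hφ)

/-- All coefficients D_x^k φ of the field lie in the ideal. The roles are not symmetric: E_χ ψ with
ψ flat need not be flat, and this asymmetry drives the nontriviality argument. -/
theorem evol_mem_flatIdeal {y : W} {φ : Sec W} (hφ : φ ∈ flatSec y) (f : DiffFun W) :
    evol φ f ∈ flatIdeal y := by
  rw [evol, vectorField_eq_sum (s := (finite_pd f).toFinset) _ fun c hc => by
    rwa [Set.Finite.mem_toFinset, Set.mem_ofPred_eq, not_not] at hc]
  refine sum_mem fun c _ => Ideal.mul_mem_right _ _ ?_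
  cases c with
  | x => exact zero_mem _
  | t => exact zero_mem _
  | jet a k => exact DxPow_mem_flatIdeal (hφ a) k

theorem evolSec_mem_flatSec {y : W} {φ : Sec W} (hφ : φ ∈ flatSec y) (ψ : Sec W) :
    evolSec φ ψ ∈ flatSec y := fun _ => evol_mem_flatIdeal hφ _

/-- Every term contains a component of q or its x-derivative as a factor, so the bracket vanishes
modulo the flat ideal. -/
theorem hamIb_mem_flatSec {y : W} (i : Fin 2) (p : Sec W) {q : Sec W} (hq : q ∈ flatSec y) :
    hamIb i p q ∈ flatSec y := by
  have h0 : ∀ j, Ideal.Quotient.mk (flatIdeal y) (q j) = 0 := fun j =>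
    Ideal.Quotient.eq_zero_iff_mem.2 (hq j)
  have h1 : ∀ j, Ideal.Quotient.mk (flatIdeal y) (Dx (q j)) = 0 := fun j =>
    Ideal.Quotient.eq_zero_iff_mem.2 (Dx_mem_flatIdeal (hq j))
  intro b
  rw [← Ideal.Quotient.eq_zero_iff_mem]
  match i with
  | 0 =>
    change Ideal.Quotient.mk (flatIdeal y) (ib₁ p q b) = 0
    fin_cases b <;> simp only [ib₁, Matrix.cons_val, Fin.isValue, Fin.zero_eta, Fin.mk_one,
      Fin.reduceFinMk, RingHom.map_sub, RingHom.map_mul, h0, h1, mul_zero, sub_zero,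
      RingHom.map_zero]
  | 1 =>
    change Ideal.Quotient.mk (flatIdeal y) (ib₂ p q b) = 0
    fin_cases b <;> simp only [ib₂, Matrix.cons_val, Fin.isValue, Fin.zero_eta, Fin.mk_one,
      Fin.reduceFinMk, RingHom.map_add, RingHom.map_sub, RingHom.map_mul, h0, h1, mul_zero,
      sub_zero, add_zero]

theorem recIb_mem_flatSec {y : W} (i : Fin 2) (φ : Sec W) {ψ : Sec W} (hψ : ψ ∈ flatSec y) :
    recIb i φ ψ ∈ flatSec y := by
  refine mulMat_mem_flatSec _ (add_mem (sub_mem (mulMat_mem_flatSec _ hψ) ?_) ?_)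
  · exact mulMat_mem_flatSec_left
      (fun j k => evol_mem_flatIdeal (recOp_mem_flatSec i hψ) (A₀inv j k)) _
  · exact hamIb_mem_flatSec i _ (mulMat_mem_flatSec _ hψ)

/-- Every other term either applies total derivatives to ψ or differentiates along ψ or R_i ψ, hence
is flat. Only the derivative of ψ along R_{a,c}φ can survive. -/
theorem deformedBracket_sub_mem_flatSec {y : W} (a : ℝ) (c : Fin 2 → ℝ) (φ : Sec W) {ψ : Sec W}
    (hψ : ψ ∈ flatSec y) : deformedBracket a c φ ψ -
      evolSec (a • φ + ∑ i, c i • recOp i φ) ψ ∈ flatSec y := by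
  have h : deformedBracket a c φ ψ - evolSec (a • φ + ∑ i, c i • recOp i φ) ψ =
      ∑ i, c i • (recIb i φ ψ - evolSec (recOp i ψ) φ) - a • evolSec ψ φ := by
    rw [← evolₗ_apply (a • φ + _), map_add, map_sum, LinearMap.add_apply, LinearMap.sum_apply]
    simp only [map_smul, LinearMap.smul_apply, evolₗ_apply, deformedBracket, recBracket, stdBracket,
      Fin.sum_univ_two, smul_add, smul_sub]
    abel
  rw [h]
  exact sub_mem (Submodule.sum_mem _ fun i _ => Submodule.smul_mem _ _
    (sub_mem (recIb_mem_flatSec i φ hψ) (evolSec_mem_flatSec (recOp_mem_flatSec i hψ) φ)))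
    (Submodule.smul_mem _ _ (evolSec_mem_flatSec hψ φ))

/-- E_χ commutes with D_x, so its commutator with T only differentiates the coefficients. It is
again an operator in total derivatives and preserves flatness. -/
theorem evolSec_toLin_sub_mem_flatSec {y : W} (T : TDOp W) (χ : Sec W) {ψ : Sec W}
    (hψ : ψ ∈ flatSec y) : evolSec χ (T.toLin ψ) - T.toLin (evolSec χ ψ) ∈ flatSec y := by
  rw [toLin_apply, toLin_apply, ← evolₗ_apply, map_sum, ← Finset.sum_sub_distrib]
  refine Submodule.sum_mem _ fun k _ => ?_
  rw [evolₗ_apply, evolSec_mulMat]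
  have h : (evolSec χ fun i => DxPow k (ψ i)) = fun i => DxPow k (evolSec χ ψ i) :=
    funext fun i => evol_DxPow χ k (ψ i)
  rw [h, add_sub_cancel_right]
  exact mulMat_mem_flatSec _ fun i => DxPow_mem_flatIdeal (hψ i) k

/-- If an operator in total derivatives intertwines a deformed bracket with the standard one, then
its difference `χ` with the deforming operator is annihilated by it on flat sections. -/
theorem toLin_evolSec_mem_flatSec {y : W} {T : TDOp W} {a : ℝ} {c : Fin 2 → ℝ} {φ ψ : Sec W}
    (hT : T.toLin (deformedBracket a c φ ψ) = stdBracket (T.toLin φ) (T.toLin ψ))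
    (hψ : ψ ∈ flatSec y) :
    T.toLin (evolSec (a • φ + ∑ i, c i • recOp i φ - T.toLin φ) ψ) ∈ flatSec y := by
  set ρ : Sec W := a • φ + ∑ i, c i • recOp i φ with hρ
  have h1 : T.toLin (deformedBracket a c φ ψ) - T.toLin (evolSec ρ ψ) ∈ flatSec y := by
    rw [← map_sub]
    exact toLin_mem_flatSec T (deformedBracket_sub_mem_flatSec a c φ hψ)
  have h2 := evolSec_toLin_sub_mem_flatSec T (T.toLin φ) hψ
  have h3 : evolSec (T.toLin ψ) (T.toLin φ) ∈ flatSec y :=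
    evolSec_mem_flatSec (toLin_mem_flatSec T hψ) _
  have h4 : T.toLin (evolSec (ρ - T.toLin φ) ψ) =
      evolSec (T.toLin φ) (T.toLin ψ) - T.toLin (evolSec (T.toLin φ) ψ) -
        (T.toLin (deformedBracket a c φ ψ) - T.toLin (evolSec ρ ψ)) -
        evolSec (T.toLin ψ) (T.toLin φ) := by
    rw [hT, ← evolₗ_apply (ρ - _), map_sub, LinearMap.sub_apply, map_sub, evolₗ_apply, evolₗ_apply,
      stdBracket]
    abel
  rw [h4]
  exact sub_mem (sub_mem h2 h1) h3

theorem DxPow_pow {ξ : DiffFun W} (hξ : Dx ξ = 1) (n m : ℕ) :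
    DxPow m (ξ ^ n) = (n.descFactorial m : ℝ) • ξ ^ (n - m) := by
  induction m with
  | zero => simp [DxPow_zero]
  | succ m ih =>
    rw [DxPow_succ, ih, Derivation.map_smul, Derivation.leibniz_pow, hξ, Nat.descFactorial_succ,
      Nat.sub_sub, smul_eq_mul, mul_one, ← Nat.cast_smul_eq_nsmul ℝ, smul_smul]
    push_cast
    rw [mul_comm]

/-- Along D_x the function ξ behaves like a coordinate centred at y, so ξ^n f vanishes there to
order n and its n-th derivative is n! f(y). -/
theorem evalAt_DxPow_pow_mul {y : W} {ξ : DiffFun W} (hξ : Dx ξ = 1) (hy : evalAt y ξ = 0)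
    (f : DiffFun W) (m n : ℕ) (hmn : m ≤ n) :
    evalAt y (DxPow m (ξ ^ n * f)) = if m = n then (n.factorial : ℝ) * evalAt y f else 0 := by
  induction m generalizing n f with
  | zero =>
    rw [DxPow_zero, map_mul, map_pow, hy]
    rcases n with _ | n
    · simp
    · simp
  | succ m ih =>
    obtain ⟨n, rfl⟩ : ∃ k, n = k + 1 := ⟨n - 1, by omega⟩
    have h : Dx (ξ ^ (n + 1) * f) = ((n + 1 : ℕ) : ℝ) • (ξ ^ n * f) + ξ ^ (n + 1) * Dx f := by
      rw [derivation_mul, Derivation.leibniz_pow, hξ, Nat.add_sub_cancel, smul_eq_mul, mul_one,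
        ← Nat.cast_smul_eq_nsmul ℝ, smul_mul_assoc]
    rw [DxPow_succ', h, map_add, map_add, map_smul, map_smul, ih f n (by omega),
      ih (Dx f) (n + 1) (by omega), if_neg (show m ≠ n + 1 by omega), add_zero]
    by_cases hmn' : m = n
    · rw [if_pos hmn', if_pos (by omega), Nat.factorial_succ, smul_eq_mul]
      push_cast
      ring
    · rw [if_neg hmn', if_neg (by omega), smul_zero]

/-- Differential functions of the form `u^a - P(x)` that are flat at a jet with finitely many
nonzero coordinates. -/
theorem exists_flat_coord {y : W} {a : Fin 3} {N : ℕ}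
    (hN : ∀ k, N ≤ k → (y : JetSpace) (.jet a k) = 0) {ξ : DiffFun W} (hξ : Dx ξ = 1)
    (hy : evalAt y ξ = 0) :
    (coord (.jet a 0) - ∑ k ∈ Finset.range N,
      ((y : JetSpace) (.jet a k) / k.factorial) • ξ ^ k : DiffFun W) ∈ flatIdeal y := by
  intro m
  have hcoord : ∀ m, DxPow m (coord (.jet a 0) : DiffFun W) = coord (.jet a m) := by
    intro m
    induction m with
    | zero => rfl
    | succ m ih => rw [DxPow_succ, ih, Dx_coord_jet]
  have hterm : ∀ k, evalAt y (DxPow m (ξ ^ k)) = if k = m then (m.factorial : ℝ) else 0 := by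
    intro k
    rw [DxPow_pow hξ, map_smul, map_pow, hy, smul_eq_mul]
    rcases lt_trichotomy k m with hkm | rfl | hkm
    · rw [Nat.descFactorial_of_lt hkm, if_neg hkm.ne, Nat.cast_zero, zero_mul]
    · rw [Nat.sub_self, pow_zero, mul_one, if_pos rfl, Nat.descFactorial_self]
    · rw [zero_pow (by omega), mul_zero, if_neg hkm.ne']
  simp only [map_sub, map_sum, map_smul, hcoord, hterm, evalAt_coord, smul_eq_mul, mul_ite, mul_zero,
    Finset.sum_ite_eq', Finset.mem_range]
  split_ifs with hm
  · rw [div_mul_cancel₀ _ (by positivity), sub_self]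
  · rw [hN m (by omega), sub_zero]

/-- Open sets of the product topology constrain finitely many coordinates near a point, so the
others can be set to zero. At such jets a polynomial in x suffices to match all derivatives of u^a.
-/
theorem exists_mem_finite_order {O : Set JetSpace} (hO : IsOpen O) (hne : O.Nonempty) :
    ∃ y ∈ O, ∃ N, ∀ a k, N ≤ k → y (.jet a k) = 0 := by
  classical
  obtain ⟨y, hy⟩ := hne
  obtain ⟨I, U, hU, hIU⟩ := isOpen_pi_iff.1 hO y hy
  have hfin : (⋃ a : Fin 3, (fun k => Coord.jet a k) ⁻¹' (I : Set Coord)).Finite :=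
    Set.finite_iUnion fun a => I.finite_toSet.preimage (fun k _ l _ h => by simpa using h)
  obtain ⟨N, hN⟩ := hfin.bddAbove
  refine ⟨fun c => if c ∈ I then y c else 0, hIU fun c hc => ?_, N + 1, fun a k hk => ?_⟩
  · have hc' : c ∈ I := hc
    simp only [hc', if_true]
    exact (hU c hc').2
  · refine if_neg fun h => ?_
    have : k ≤ N := hN (Set.mem_iUnion.2 ⟨a, h⟩)
    omega

/-- An operator `T` in total derivatives without zeros that annihilates `E_χ` on flat sections
forces `χ = 0`. -/
theorem eq_zero_of_toLin_evolSec_mem_flatSec {T : TDOp W} {χ : Sec W}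
    (hT : ∀ y : W, ∃ k i j, evalAt y (T k i j) ≠ 0)
    (h : ∀ y : W, ∀ ψ ∈ flatSec y, T.toLin (evolSec χ ψ) ∈ flatSec y) : χ = 0 := by
  classical
  by_contra hχ
  obtain ⟨a, ha⟩ : ∃ a, χ a ≠ 0 := Function.ne_iff.1 hχ
  obtain ⟨y₀, hy₀⟩ : ∃ y, (χ a : W → ℝ) y ≠ 0 := by
    by_contra! h
    exact ha (Subtype.ext (funext h))
  have hopen : IsOpen (Subtype.val '' {y : W | (χ a : W → ℝ) y ≠ 0}) :=
    W.isOpen.isOpenMap_subtype_val _ (isOpen_ne_fun (DiffFun.continuous (χ a)) continuous_const)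
  obtain ⟨_, ⟨y, hy, rfl⟩, N, hN⟩ := exists_mem_finite_order hopen ⟨_, y₀, hy₀, rfl⟩
  -- The relevant order n is the largest one whose coefficient is nonzero at y itself; higher
  -- coefficients may be nonzero elsewhere but do not contribute to the value at y.
  let S : Finset ℕ := T.support.filter fun k => ∃ i j, evalAt y (T k i j) ≠ 0
  have hS : S.Nonempty := by
    obtain ⟨k, i, j, hk⟩ := hT y
    refine ⟨k, Finset.mem_filter.2 ⟨Finsupp.mem_support_iff.2 fun h0 => hk ?_, i, j, hk⟩⟩
    rw [h0, Matrix.zero_apply, map_zero]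
  obtain ⟨n, hnS, hmax⟩ := S.exists_max_image id hS
  obtain ⟨hnT, i, j, hij⟩ := Finset.mem_filter.1 hnS
  let ξ : DiffFun W := coord .x - algebraMap ℝ _ ((y : JetSpace) .x)
  have hξ : Dx ξ = 1 := by
    rw [map_sub, Dx_coord_x, Derivation.map_algebraMap, sub_zero]
  have hξy : evalAt y ξ = 0 := by
    rw [map_sub, evalAt_coord, AlgHom.commutes]
    exact sub_self _
  have hξE : evol χ ξ = 0 := by
    rw [map_sub, evol_coord_x, Derivation.map_algebraMap, sub_zero]
  have hξpow : ∀ k, evol χ (ξ ^ k) = 0 := fun k => by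
    rw [Derivation.leibniz_pow, hξE, smul_zero, smul_zero]
  have hflat := exists_flat_coord (a := a) (hN a) hξ hξy
  set g : DiffFun W := coord (.jet a 0) - ∑ k ∈ Finset.range N,
      ((y : JetSpace) (.jet a k) / k.factorial) • ξ ^ k with hg
  have hgE : evol χ g = χ a := by
    rw [hg, map_sub, map_sum, evol_coord_jet, DxPow_zero, sub_eq_self]
    exact Finset.sum_eq_zero fun k _ => by rw [Derivation.map_smul, hξpow, smul_zero]
  -- The factor g makes ψ flat, but E_χ g = χ^a with χ^a(y) ≠ 0. The factor ξ^n isolates the order n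
  -- of T, so the i-th component of T(E_χ ψ) at y is n! (T_n)_{ij}(y) χ^a(y).
  let ψ : Sec W := Pi.single j (ξ ^ n * g)
  have hψ : ψ ∈ flatSec y := by
    intro l
    by_cases hl : l = j
    · subst hl
      rw [show ψ l = ξ ^ n * g from Pi.single_eq_same _ _]
      exact Ideal.mul_mem_left _ _ hflat
    · rw [show ψ l = 0 from Pi.single_eq_of_ne hl _]
      exact zero_mem _
  have hψE : ∀ l, evolSec χ ψ l = if l = j then ξ ^ n * χ a else 0 := by
    intro l
    by_cases hl : l = j
    · subst hl
      rw [if_pos rfl, evolSec, show ψ l = ξ ^ n * g from Pi.single_eq_same _ _, derivation_mul,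
        hξpow, hgE, zero_mul, zero_add]
    · rw [if_neg hl, evolSec, show ψ l = 0 from Pi.single_eq_of_ne hl _, map_zero]
  have hval := h y ψ hψ i 0
  have hentry : ∀ k, evalAt y (mulMat (T k) (fun l => DxPow k (evolSec χ ψ l)) i) =
      evalAt y (T k i j) * evalAt y (DxPow k (ξ ^ n * χ a)) := by
    intro k
    change evalAt y (∑ l, T k i l * DxPow k (evolSec χ ψ l)) = _
    rw [Finset.sum_eq_single j, hψE, if_pos rfl, map_mul]
    · intro l _ hl
      rw [hψE, if_neg hl, map_zero, mul_zero]
    · simp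
  rw [DxPow_zero, toLin_apply, Finset.sum_apply, map_sum] at hval
  simp only [hentry] at hval
  rw [Finset.sum_eq_single n] at hval
  · rw [evalAt_DxPow_pow_mul hξ hξy _ n n le_rfl, if_pos rfl] at hval
    exact mul_ne_zero hij (mul_ne_zero (by positivity) hy) hval
  · intro k hk hkn
    rcases lt_or_gt_of_ne hkn with hlt | hgt
    · rw [evalAt_DxPow_pow_mul hξ hξy _ k n hlt.le, if_neg hkn, mul_zero]
    · have h0 : evalAt y (T k i j) = 0 := by
        by_contra hne
        exact absurd (hmax k (Finset.mem_filter.2 ⟨hk, i, j, hne⟩)) (not_le.2 hgt)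
      rw [h0, zero_mul]
  · exact fun hn => absurd hnT hn

/-- The deformations are nontrivial. -/
theorem not_isTrivialDeformation (hW : W ≤ regularJets) (hne : (W : Set JetSpace).Nonempty) (a : ℝ)
    {c : Fin 2 → ℝ} (hc : c ≠ 0) :
    ¬ IsTrivialDeformation (deformedBracket a c : Sec W → Sec W → Sec W) := by
  rintro ⟨T, hbij, hT⟩
  have hA := isUnit_A₀mat hW
  obtain ⟨φ, hφ, hTφ⟩ := hbij.surjOn (A₀_mem_symmetries dilation_mem)
  -- If all coefficients of T vanished at y, so would every symmetry in its image, in particular the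
  -- translation (u_x, v_x, w_x) = A₀(0,0,1). It is the last column of A₀, which is invertible at y.
  have hTne : ∀ y : W, ∃ k i j, evalAt y (T k i j) ≠ 0 := by
    intro y
    by_contra! h0
    obtain ⟨θ, -, hθ⟩ := hbij.surjOn (A₀_mem_symmetries const_mem₂)
    have hzero : ∀ i, evalAt y (A₀.toLin ![0, 0, 1] i) = 0 := by
      intro i
      rw [← hθ, toLin_apply, Finset.sum_apply, map_sum]
      refine Finset.sum_eq_zero fun k _ => ?_
      rw [mulMat_apply]
      simp only [map_add, map_mul, h0, zero_mul, add_zero]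
    have hy := hW y.2
    apply hy
    have e0 : (y : JetSpace) (.jet 0 1) = 0 := by
      rw [← evalAt_coord, ← hzero 0]
      simp [A₀_apply, ux]
    have e1 : (y : JetSpace) (.jet 1 1) = 0 := by
      rw [← evalAt_coord, ← hzero 1]
      simp [A₀_apply, vx]
    have e2 : (y : JetSpace) (.jet 2 1) = 0 := by
      rw [← evalAt_coord, ← hzero 2]
      simp [A₀_apply, wx]
    simp [noetherMatrix, Matrix.det_fin_three, e0, e1, e2]
  -- Hence R_{a,c}φ = Tφ, and φ was chosen so that Tφ is the dilation symmetry.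
  have hχ := eq_zero_of_toLin_evolSec_mem_flatSec hTne fun y ψ hψ =>
    toLin_evolSec_mem_flatSec (hT φ ψ) hψ
  rw [hTφ, sub_eq_zero, ← A₀_A₀inv hA φ, add_sum_recOp hA] at hχ
  exact noetherComb_ne_dilation hne a hc _ hχ

end DispersionlessBoussinesq

end

open DispersionlessBoussinesq in
theorem mainTheorem4 :
    (∀ W : TopologicalSpace.Opens JetSpace,
      ((∀ p ∈ cosymmetries W, A₀.toLin p ∈ symmetries W) ∧
        (∀ p ∈ cosymmetries W, A₁.toLin p ∈ symmetries W) ∧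
        (∀ p ∈ cosymmetries W, A₂.toLin p ∈ symmetries W)) ∧
      HasInvolutiveImage (cosymmetries W) A₀.toLin ∧
      LinearCompatible (cosymmetries W) ![A₀.toLin, A₁.toLin, A₂.toLin]) ∧
    Dense (regularJets : Set JetSpace) ∧
    ∀ W : TopologicalSpace.Opens JetSpace, W ≤ regularJets → (W : Set JetSpace).Nonempty →
      (IsUnit (A₀mat : Matrix (Fin 3) (Fin 3) (DiffFun W)) ∧
        (∀ φ ∈ symmetries W, mulMat A₀inv φ ∈ cosymmetries W) ∧
        ∀ i, ∀ φ ∈ symmetries W, recOp i φ ∈ symmetries W) ∧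
      LinearCompatible (symmetries W) recOp ∧
      (∀ (a : ℝ) (c : Fin 2 → ℝ) (φ ψ : Sec W),
        stdBracket (a • φ + ∑ i, c i • recOp i φ) (a • ψ + ∑ i, c i • recOp i ψ) =
          a • deformedBracket a c φ ψ + ∑ i, c i • recOp i (deformedBracket a c φ ψ)) ∧
      (∀ (a : ℝ) (c : Fin 2 → ℝ), IsLieBracketOn (symmetries W) (deformedBracket a c)) ∧
      Module.finrank ℝ (Submodule.span ℝ (Set.range fun i : Fin 2 =>
        onSym (recBracket i : Sec W → Sec W → Sec W))) = 2 ∧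
      LinearIndependent ℝ ![onSym (stdBracket : Sec W → Sec W → Sec W),
        onSym (recBracket 0), onSym (recBracket 1)] ∧
      ∀ (a : ℝ) (c : Fin 2 → ℝ), c ≠ 0 →
        ¬ IsTrivialDeformation (deformedBracket a c : Sec W → Sec W → Sec W) := by
  refine ⟨fun W => ⟨⟨fun p => A₀_mem_symmetries, fun p => A₁_mem_symmetries,
    fun p => A₂_mem_symmetries⟩, linearCompatible_noether.1 0, linearCompatible_noether⟩,
    dense_regularJets, fun W hW hne => ?_⟩
  have hA := isUnit_A₀mat hW
  exact ⟨⟨hA, fun φ => A₀inv_mem hA, fun i φ => recOp_mem hA i⟩, linearCompatible_recOp hA,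
    stdBracket_deformed hA, isLieBracketOn_deformedBracket hA, finrank_span_recBracket hA hne,
    linearIndependent_brackets hA hne, fun a c hc => not_isTrivialDeformation hW hne a hc⟩
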